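/- Let $R=\mathbb{Z}[U,V,W,X,Y,Z]/(UX+VY+WZ)$, let $u,v,w,x,y,z$ denote the images of the variables in $R$, let $\mathfrak a=(x,y,z)R$, and let $H^3_{\mathfrak a}(R)=\varinjlim_t \mathrm{Ext}^3_R(R/\mathfrak a^t,R)$ be the third local cohomology module of $R$ with support in $\mathfrak a$. Then $H^3_{\mathfrak a}(R)$ is isomorphic, as an $R$-module, to the direct limit $\varinjlim_k R/(x^k,y^k,z^k)R$, whose transition maps are induced by multiplication by $xyz$. For every prime number $p$, there is a unique element $\lambda\in R$ with $p\lambda=(ux)^p+(vy)^p+(wz)^p$, written $\lambda=\frac{(ux)^p+(vy)^p+(wz)^p}{p}$. Under every $R$-linear isomorphism of $H^3_{\mathfrak a}(R)$ with this direct limit, the element $\eta\in H^3_{\mathfrak a}(R)$ that corresponds to the class of $\lambda+(x^p,y^p,z^p)R$ is nonzero and satisfies $p\,\eta=0$. Moreover, $H^3_{\mathfrak a}(R)$ has infinitely many associated prime ideals. -/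

import Mathlib

/-- The polynomial ring `ℤ[U, V, W, X, Y, Z]`, the variables being numbered `0, …, 5` in this
order. -/
abbrev SixVarRing : Type := MvPolynomial (Fin 6) ℤ

namespace SixVarRing

noncomputable section

/-- The polynomial `UX + VY + WZ`. -/
def quadric : SixVarRing :=
  MvPolynomial.X 0 * MvPolynomial.X 3 + MvPolynomial.X 1 * MvPolynomial.X 4
    + MvPolynomial.X 2 * MvPolynomial.X 5

end

end SixVarRing

/-- The hypersurface `R = ℤ[U, V, W, X, Y, Z] / (UX + VY + WZ)`. -/
abbrev HypersurfaceRing : Type := SixVarRing ⧸ Ideal.span {SixVarRing.quadric}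

namespace HypersurfaceRing

noncomputable section

/-- The image in `R` of the `i`-th variable of `ℤ[U, V, W, X, Y, Z]`. -/
def coord (i : Fin 6) : HypersurfaceRing :=
  Ideal.Quotient.mk (Ideal.span {SixVarRing.quadric}) (MvPolynomial.X i)

/-- The image of `U` in `R`. -/
def u : HypersurfaceRing := coord 0
/-- The image of `V` in `R`. -/
def v : HypersurfaceRing := coord 1
/-- The image of `W` in `R`. -/
def w : HypersurfaceRing := coord 2
/-- The image of `X` in `R`. -/
def x : HypersurfaceRing := coord 3
/-- The image of `Y` in `R`. -/
def y : HypersurfaceRing := coord 4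
/-- The image of `Z` in `R`. -/
def z : HypersurfaceRing := coord 5

/-- The ideal `𝔞 = (x, y, z)R`. -/
def idealXYZ : Ideal HypersurfaceRing := Ideal.span {x, y, z}

/-- The local cohomology module `H³_𝔞(R)`, that is, the direct limit of `Ext³_R(R/𝔞ᵗ, R)`. -/
abbrev H3 : ModuleCat.{0} HypersurfaceRing :=
  (localCohomology idealXYZ 3).obj (ModuleCat.of HypersurfaceRing HypersurfaceRing)

end

end HypersurfaceRing

namespace ThreePowers

noncomputable section

variable {A : Type*} [CommRing A]

/-- The ideal `(aᵏ, bᵏ, cᵏ)`. -/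
def powIdeal (a b c : A) (k : ℕ) : Ideal A := Ideal.span {a ^ k, b ^ k, c ^ k}

theorem powIdeal_le_comap (a b c : A) {i j : ℕ} (h : i ≤ j) :
    powIdeal a b c i ≤
      Submodule.comap (LinearMap.mulLeft A ((a * b * c) ^ (j - i))) (powIdeal a b c j) := by
  obtain ⟨d, rfl⟩ := Nat.exists_eq_add_of_le h
  rw [powIdeal, Ideal.span, Submodule.span_le]
  intro t ht
  have ha : a ^ (i + d) ∈ powIdeal a b c (i + d) := Ideal.subset_span (by simp)
  have hb : b ^ (i + d) ∈ powIdeal a b c (i + d) := Ideal.subset_span (by simp)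
  have hc : c ^ (i + d) ∈ powIdeal a b c (i + d) := Ideal.subset_span (by simp)
  simp only [Set.mem_insert_iff, Set.mem_singleton_iff] at ht
  simp only [SetLike.mem_coe, Submodule.mem_comap, LinearMap.mulLeft_apply,
    Nat.add_sub_cancel_left]
  rcases ht with rfl | rfl | rfl
  · convert Ideal.mul_mem_left _ ((b * c) ^ d) ha using 1; ring
  · convert Ideal.mul_mem_left _ ((a * c) ^ d) hb using 1; ring
  · convert Ideal.mul_mem_left _ ((a * b) ^ d) hc using 1; ring

/-- The map `A/(aⁱ, bⁱ, cⁱ) → A/(aʲ, bʲ, cʲ)` induced by multiplication by `(abc)ʲ⁻ⁱ`. -/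
def transition (a b c : A) (i j : ℕ) (h : i ≤ j) :
    (A ⧸ powIdeal a b c i) →ₗ[A] (A ⧸ powIdeal a b c j) :=
  Submodule.mapQ (powIdeal a b c i) (powIdeal a b c j)
    (LinearMap.mulLeft A ((a * b * c) ^ (j - i))) (powIdeal_le_comap a b c h)

/-- The direct limit of the modules `A/(aᵏ, bᵏ, cᵏ)`, whose transition maps are induced by
multiplication by `abc`. -/
abbrev Limit (a b c : A) : Type _ :=
  Module.DirectLimit (fun k : ℕ => A ⧸ powIdeal a b c k) (transition a b c)

/-- The class of `r + (aᵏ, bᵏ, cᵏ)` in the direct limit. -/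
def cls (a b c : A) (k : ℕ) (r : A) : Limit a b c :=
  Module.DirectLimit.of A ℕ (fun k : ℕ => A ⧸ powIdeal a b c k) (transition a b c) k
    (Submodule.Quotient.mk r)

end

end ThreePowers

/-! Nonvanishing of `η` means that `(xyz)^k λ ∉ (x^(p+k), y^(p+k), z^(p+k))` for every `k`. To test
this, `R` is mapped to Laurent polynomials in `a, b, c` over a ring `T` by `x, y, z ↦ a, b, c` and
`u, v, w ↦ α/a, β/b, γ/c`, where `α + β + γ = 0`. A negative power of `a` comes only from `u` and
carries as many factors `α`. Comparing coefficients of `(abc)^k` therefore puts the constant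
coefficient `G` of the image of `λ` into `(α^p, β^p, γ^p)` (`coeff_toLaurent_mem`), while `pG = α^p
+ β^p + γ^p`. Over the dual numbers of `ℤ[X]`, with `α = X`, `β = ε`, `γ = -(X + ε)`, this forces `p
∣ 1` (`xyz_pow_mul_notMem`). An associated prime above a nonzero `p`-torsion element contains `p`,
and no prime ideal contains two prime numbers, so there are infinitely many.

For the identification of the local cohomology, `x, y` is a regular sequence, but `z` is not regular
modulo `(x, y)`: `wz` lies in `(x, y)` and `w` does not. Hence the Koszul complexes of `x^n, y^n,
z^n` are not resolutions. The obstruction is the homology in degree `1`, and Noetherianity makes the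
transition from `n + e` to `n` kill it for suitable `e` (`exists_isProExact`). Chain maps from
Koszul complexes to resolutions always exist; maps back exist after such a transition
(`IsProExact.exists_lift`). So `Ext³(R/(x^n, y^n, z^n), R) → R/(x^n, y^n, z^n)` becomes bijective in
the limit (`exists_toQuot`), and the ideals `(x^n, y^n, z^n)` are cofinal with the powers of `𝔞`. -/

namespace ThreePowers

variable {A : Type*} [CommRing A]

theorem transition_mk (a b c : A) {i j : ℕ} (h : i ≤ j) (r : A) :
    transition a b c i j h (Submodule.Quotient.mk r) =
      Submodule.Quotient.mk ((a * b * c) ^ (j - i) * r) :=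
  rfl

/-- Lets vanishing in the limit be read off at a finite stage, through
`Module.DirectLimit.of.zero_exact`. -/
instance directedSystem_transition (a b c : A) :
    DirectedSystem (fun k : ℕ => A ⧸ powIdeal a b c k) (transition a b c · · ·) where
  map_self i r := by
    obtain ⟨r, rfl⟩ := Submodule.Quotient.mk_surjective _ r
    rw [transition_mk, Nat.sub_self, pow_zero, one_mul]
  map_map i j k hij hjk r := by
    obtain ⟨r, rfl⟩ := Submodule.Quotient.mk_surjective _ r
    rw [transition_mk, transition_mk, transition_mk, ← mul_assoc, ← pow_add]
    congr 3
    omega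

end ThreePowers

/-! ### Regular elements of the hypersurface and existence of `λ` -/

namespace SixVarRing

theorem not_C_prime_dvd_quadric {p : ℕ} (hp : p.Prime) :
    ¬ (MvPolynomial.C (p : ℤ) : SixVarRing) ∣ quadric := by
  rintro ⟨G, h⟩
  -- At this point the quadric takes the value `1`.
  have := congrArg (MvPolynomial.eval (![1, 0, 0, 1, 0, 0] : Fin 6 → ℤ)) h
  simp only [quadric, map_add, map_mul, MvPolynomial.eval_X, MvPolynomial.eval_C] at this
  simp at this
  have h1 : (p : ℤ) ∣ 1 := ⟨_, this⟩
  exact hp.one_lt.ne' (by exact_mod_cast Int.eq_one_of_dvd_one (by positivity) h1)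

end SixVarRing

namespace HypersurfaceRing

theorem relation : u * x + v * y + w * z = 0 := by
  have : Ideal.Quotient.mk (Ideal.span {SixVarRing.quadric}) SixVarRing.quadric = 0 :=
    Ideal.Quotient.eq_zero_iff_mem.2 (Ideal.subset_span rfl)
  rw [← this]
  rfl

/-- A prime polynomial that does not divide `UX + VY + WZ` is regular on the hypersurface `R`. -/
theorem eq_zero_of_mk_prime_mul_eq_zero {π : SixVarRing} (hπ : Prime π)
    (hdvd : ¬ π ∣ SixVarRing.quadric) {a : HypersurfaceRing}
    (h : Ideal.Quotient.mk (Ideal.span {SixVarRing.quadric}) π * a = 0) : a = 0 := by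
  obtain ⟨F, rfl⟩ := Ideal.Quotient.mk_surjective a
  rw [← map_mul, Ideal.Quotient.eq_zero_iff_mem, Ideal.mem_span_singleton] at h
  rw [Ideal.Quotient.eq_zero_iff_mem, Ideal.mem_span_singleton]
  obtain ⟨G, hG⟩ := h
  obtain ⟨G', rfl⟩ := (hπ.dvd_or_dvd (⟨F, hG.symm⟩ : _ ∣ SixVarRing.quadric * G)).resolve_left hdvd
  exact ⟨G', mul_left_cancel₀ hπ.ne_zero (by rw [hG]; ring)⟩

/-- Multiplication by a prime number is injective on the hypersurface `R`. -/
theorem eq_zero_of_prime_mul_eq_zero {p : ℕ} (hp : p.Prime) {a : HypersurfaceRing}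
    (h : (p : HypersurfaceRing) * a = 0) : a = 0 :=
  eq_zero_of_mk_prime_mul_eq_zero
    ((MvPolynomial.prime_C_iff _).2 (Nat.prime_iff_prime_int.1 hp))
    (SixVarRing.not_C_prime_dvd_quadric hp) (by simpa using h)

theorem x_regular (s : HypersurfaceRing) (h : x * s = 0) : s = 0 := by
  refine eq_zero_of_mk_prime_mul_eq_zero (π := MvPolynomial.X 3) MvPolynomial.X_prime ?_ h
  rintro ⟨G, hG⟩
  have := congrArg (MvPolynomial.eval (![0, 1, 0, 0, 1, 0] : Fin 6 → ℤ)) hG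
  simp [SixVarRing.quadric] at this

/-- The endomorphism of `ℤ[U, V, W, X, Y, Z]` that sends `X` to `0` is the identity modulo `X`. -/
theorem _root_.SixVarRing.X_dvd_sub_aeval (F : SixVarRing) :
    (MvPolynomial.X 3 : SixVarRing) ∣
      F - MvPolynomial.aeval (Function.update MvPolynomial.X 3 (0 : SixVarRing)) F := by
  have h : (Ideal.Quotient.mkₐ ℤ (Ideal.span {(MvPolynomial.X 3 : SixVarRing)})).comp
      (MvPolynomial.aeval (Function.update MvPolynomial.X 3 (0 : SixVarRing))) =
      Ideal.Quotient.mkₐ ℤ _ := by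
    refine MvPolynomial.algHom_ext fun i => ?_
    rw [AlgHom.comp_apply, MvPolynomial.aeval_X]
    by_cases hi : i = 3
    · subst hi
      rw [Function.update_self, map_zero]
      exact (Ideal.Quotient.eq_zero_iff_mem.2 (Ideal.mem_span_singleton_self _)).symm
    · rw [Function.update_of_ne hi]
  rw [← Ideal.mem_span_singleton, ← Ideal.Quotient.eq]
  exact (AlgHom.congr_fun h F).symm

/-- Setting `X = 0` turns the quadric into `VY + WZ`, which the prime `Y` does not divide. A
relation `YF - XG = qH` thus makes `F` at `X = 0` a multiple of `VY + WZ`, and `F` lies in `(X, q)`.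
-/
theorem y_regular_mod_x (s : HypersurfaceRing) (h : x ∣ y * s) : x ∣ s := by
  obtain ⟨t, ht⟩ := h
  obtain ⟨F, rfl⟩ := Ideal.Quotient.mk_surjective s
  obtain ⟨G, rfl⟩ := Ideal.Quotient.mk_surjective t
  have hmem : (MvPolynomial.X 4 * F - MvPolynomial.X 3 * G : SixVarRing) ∈
      Ideal.span {SixVarRing.quadric} := Ideal.Quotient.eq.1 ht
  obtain ⟨H, hH⟩ := Ideal.mem_span_singleton.1 hmem
  let σ : SixVarRing →ₐ[ℤ] SixVarRing :=
    MvPolynomial.aeval (Function.update MvPolynomial.X 3 (0 : SixVarRing))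
  have hσ3 : σ (MvPolynomial.X 3) = 0 := by simp [σ]
  have hσ : ∀ i, i ≠ 3 → σ (MvPolynomial.X i) = MvPolynomial.X i := fun i hi => by
    simp [σ, Function.update_of_ne hi]
  have hq : σ SixVarRing.quadric = SixVarRing.quadric - MvPolynomial.X 0 * MvPolynomial.X 3 := by
    rw [SixVarRing.quadric, map_add, map_add, map_mul, map_mul, map_mul, hσ3, hσ 0 (by decide),
      hσ 1 (by decide), hσ 2 (by decide), hσ 4 (by decide), hσ 5 (by decide)]
    ring
  have hH' := congrArg σ hH
  rw [map_sub, map_mul, map_mul, map_mul, hσ3, hσ 4 (by decide), hq, zero_mul, sub_zero] at hH'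
  have hY : Prime (MvPolynomial.X 4 : SixVarRing) := MvPolynomial.X_prime
  obtain ⟨H', hH''⟩ := (hY.dvd_or_dvd ⟨_, hH'.symm⟩).resolve_left (by
    rintro ⟨G', hG'⟩
    have := congrArg (MvPolynomial.eval (![0, 0, 1, 0, 0, 1] : Fin 6 → ℤ)) hG'
    simp [SixVarRing.quadric] at this)
  have hF : σ F = (SixVarRing.quadric - MvPolynomial.X 0 * MvPolynomial.X 3) * H' :=
    mul_left_cancel₀ hY.ne_zero (by rw [hH', hH'']; ring)
  obtain ⟨F', hF'⟩ := SixVarRing.X_dvd_sub_aeval F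
  refine ⟨Ideal.Quotient.mk _ (F' - MvPolynomial.X 0 * H'), Ideal.Quotient.eq.2 ?_⟩
  refine Ideal.mem_span_singleton.2 ⟨H', ?_⟩
  linear_combination hF' + hF

/-- The divisibility of `(s + t)^p - s^p - t^p` by `p` is applied to `ux + vy` and then to `(ux +
vy) + wz = 0`. -/
theorem exists_prime_mul_eq {p : ℕ} (hp : p.Prime) :
    ∃ l : HypersurfaceRing,
      (p : HypersurfaceRing) * l = (u * x) ^ p + (v * y) ^ p + (w * z) ^ p := by
  obtain ⟨r, hr⟩ := exists_add_pow_prime_eq hp (u * x) (v * y)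
  obtain ⟨s, hs⟩ := exists_add_pow_prime_eq hp (u * x + v * y) (w * z)
  rw [relation, zero_pow hp.ne_zero] at hs
  refine ⟨-(u * x * (v * y) * r) - (u * x + v * y) * (w * z) * s, ?_⟩
  linear_combination hr + hs

/-! ### Laurent polynomials and nonvanishing of the classes -/

section Laurent

variable {T : Type} [CommRing T]

open AddMonoidAlgebra

/-- The images of the six variables under `SixVarRing.toLaurent`. -/
noncomputable def laurentVar (α β γ : T) : Fin 6 → AddMonoidAlgebra T (ℤ × ℤ × ℤ) :=
  ![single (-1, 0, 0) α, single (0, -1, 0) β, single (0, 0, -1) γ,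
    single (1, 0, 0) 1, single (0, 1, 0) 1, single (0, 0, 1) 1]

/-- The homomorphism to the ring of Laurent polynomials in `a, b, c` over `T` that sends `X, Y, Z`
to `a, b, c` and `U, V, W` to `α / a, β / b, γ / c`. -/
noncomputable def _root_.SixVarRing.toLaurent (α β γ : T) :
    SixVarRing →+* AddMonoidAlgebra T (ℤ × ℤ × ℤ) :=
  MvPolynomial.eval₂Hom (Int.castRingHom _) (laurentVar α β γ)

/-- Only the image `α/a` of `U` lowers the exponent of `a`, and each use contributes a factor `α`;
likewise for `b` and `c`. -/
theorem _root_.SixVarRing.coeff_toLaurent_dvd (α β γ : T) (F : SixVarRing) (i j k : ℤ) (n : ℕ) :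
    (i ≤ -n → α ^ n ∣ (SixVarRing.toLaurent α β γ F).coeff (i, j, k)) ∧
    (j ≤ -n → β ^ n ∣ (SixVarRing.toLaurent α β γ F).coeff (i, j, k)) ∧
    (k ≤ -n → γ ^ n ∣ (SixVarRing.toLaurent α β γ F).coeff (i, j, k)) := by
  induction F using MvPolynomial.induction_on generalizing i j k n with
  | C a =>
    have h1 : SixVarRing.toLaurent α β γ (MvPolynomial.C a) = single 0 (a : T) := by
      rw [eq_intCast, map_intCast, AddMonoidAlgebra.intCast_def]
    rw [h1, coeff_single, Finsupp.single_apply]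
    split_ifs with h
    · simp only [Prod.ext_iff, Prod.fst_zero, Prod.snd_zero] at h
      obtain ⟨rfl, rfl, rfl⟩ := h
      rcases n with _ | n
      · simp
      · refine ⟨?_, ?_, ?_⟩ <;> intro h <;> push_cast at h <;> omega
    · simp
  | add F G hF hG =>
    simp only [map_add, coeff_add, Finsupp.add_apply]
    exact ⟨fun h => dvd_add ((hF i j k n).1 h) ((hG i j k n).1 h),
      fun h => dvd_add ((hF i j k n).2.1 h) ((hG i j k n).2.1 h),
      fun h => dvd_add ((hF i j k n).2.2 h) ((hG i j k n).2.2 h)⟩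
  | mul_X F m hF =>
    have key : ∀ (i' j' k' : ℤ) (t : T),
        (SixVarRing.toLaurent α β γ F * single (i', j', k') t).coeff (i, j, k) =
          (SixVarRing.toLaurent α β γ F).coeff (i - i', j - j', k - k') * t := by
      intro i' j' k' t
      rw [coeff_mul_single_apply]
      rfl
    -- The bound for `n + 1` follows from the one for `n`: the missing factor is the coefficient of
    -- the variable just multiplied in.
    have lift : ∀ {s t : T} {i' : ℤ}, (∀ n : ℕ, i' ≤ -n → s ^ n ∣ t) → i' - 1 ≤ -n →
        s ^ n ∣ t * s := by
      intro s t i' h hi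
      rcases n with _ | n
      · simp
      · rw [pow_succ]
        exact mul_dvd_mul_right (h n (by push_cast at hi; omega)) s
    have hX : SixVarRing.toLaurent α β γ (F * MvPolynomial.X m) =
        SixVarRing.toLaurent α β γ F * laurentVar α β γ m := by
      simp [SixVarRing.toLaurent]
    rw [hX]
    fin_cases m <;> simp only [laurentVar, Fin.zero_eta, Fin.mk_one, Fin.reduceFinMk,
      Matrix.cons_val] <;> rw [key]
    · exact ⟨fun h => lift (fun n h' => (hF _ _ _ n).1 h') (by omega),
        fun h => Dvd.dvd.mul_right ((hF _ _ _ n).2.1 (by omega)) _,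
        fun h => Dvd.dvd.mul_right ((hF _ _ _ n).2.2 (by omega)) _⟩
    · exact ⟨fun h => Dvd.dvd.mul_right ((hF _ _ _ n).1 (by omega)) _,
        fun h => lift (fun n h' => (hF _ _ _ n).2.1 h') (by omega),
        fun h => Dvd.dvd.mul_right ((hF _ _ _ n).2.2 (by omega)) _⟩
    · exact ⟨fun h => Dvd.dvd.mul_right ((hF _ _ _ n).1 (by omega)) _,
        fun h => Dvd.dvd.mul_right ((hF _ _ _ n).2.1 (by omega)) _,
        fun h => lift (fun n h' => (hF _ _ _ n).2.2 h') (by omega)⟩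
    all_goals
      exact ⟨fun h => Dvd.dvd.mul_right ((hF _ _ _ n).1 (by omega)) _,
        fun h => Dvd.dvd.mul_right ((hF _ _ _ n).2.1 (by omega)) _,
        fun h => Dvd.dvd.mul_right ((hF _ _ _ n).2.2 (by omega)) _⟩

theorem _root_.SixVarRing.toLaurent_quadric {α β γ : T} (h : α + β + γ = 0) :
    SixVarRing.toLaurent α β γ SixVarRing.quadric = 0 := by
  have : (0 : ℤ × ℤ × ℤ) = (0, 0, 0) := rfl
  simp [SixVarRing.toLaurent, SixVarRing.quadric, laurentVar, single_mul_single, ← single_add, h]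

/-- The homomorphism induced by `SixVarRing.toLaurent` on the hypersurface. -/
noncomputable def toLaurent {α β γ : T} (h : α + β + γ = 0) :
    HypersurfaceRing →+* AddMonoidAlgebra T (ℤ × ℤ × ℤ) :=
  Ideal.Quotient.lift _ (SixVarRing.toLaurent α β γ) fun a ha => by
    obtain ⟨c, rfl⟩ := Ideal.mem_span_singleton.1 ha
    rw [map_mul, SixVarRing.toLaurent_quadric h, zero_mul]

theorem toLaurent_coord {α β γ : T} (h : α + β + γ = 0) (m : Fin 6) :
    toLaurent h (coord m) = laurentVar α β γ m := by
  simp [toLaurent, coord, SixVarRing.toLaurent]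

/-- A multiple of `(xyz)ᵏ` in `(xⁿ⁺ᵏ, yⁿ⁺ᵏ, zⁿ⁺ᵏ)` has its coefficient of degree `0` in the ideal
`(αⁿ, βⁿ, γⁿ)`. -/
theorem coeff_toLaurent_mem {α β γ : T} (h : α + β + γ = 0) (n k : ℕ) (l : HypersurfaceRing)
    (hl : (x * y * z) ^ k * l ∈ ThreePowers.powIdeal x y z (n + k)) :
    ∃ g₁ g₂ g₃ : T, (toLaurent h l).coeff 0 = α ^ n * g₁ + β ^ n * g₂ + γ ^ n * g₃ := by
  obtain ⟨c₁, c₂, c₃, hc⟩ := Submodule.mem_span_triple.1 hl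
  obtain ⟨F₁, rfl⟩ := Ideal.Quotient.mk_surjective c₁
  obtain ⟨F₂, rfl⟩ := Ideal.Quotient.mk_surjective c₂
  obtain ⟨F₃, rfl⟩ := Ideal.Quotient.mk_surjective c₃
  have e1 : ∀ m : ℕ, toLaurent h (x ^ m) = single ((m : ℤ), 0, 0) 1 := by
    intro m; rw [map_pow, x, toLaurent_coord]; simp [laurentVar, single_pow]
  have e2 : ∀ m : ℕ, toLaurent h (y ^ m) = single (0, (m : ℤ), 0) 1 := by
    intro m; rw [map_pow, y, toLaurent_coord]; simp [laurentVar, single_pow]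
  have e3 : ∀ m : ℕ, toLaurent h (z ^ m) = single (0, 0, (m : ℤ)) 1 := by
    intro m; rw [map_pow, z, toLaurent_coord]; simp [laurentVar, single_pow]
  -- At the exponent `(k, k, k)` the term `c₁ x^(n+k)` contributes the coefficient of `c₁` with
  -- `a`-exponent `k - (n + k) = -n`, a multiple of `α^n`.
  have hc' := congrArg (fun r => (toLaurent h r).coeff ((k : ℤ), (k : ℤ), (k : ℤ))) hc
  simp only [smul_eq_mul, map_add, map_mul, mul_pow, e1, e2, e3, single_mul_single, coeff_add,
    Finsupp.add_apply, coeff_mul_single_apply, coeff_single_mul_apply] at hc'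
  have hmk : ∀ F : SixVarRing, toLaurent h (Ideal.Quotient.mk _ F) = SixVarRing.toLaurent α β γ F :=
    fun F => rfl
  simp only [hmk, Prod.neg_mk, Prod.mk_add_mk, neg_zero, add_zero, zero_add, mul_one, one_mul,
    neg_add_cancel] at hc'
  obtain ⟨g₁, h₁⟩ := (SixVarRing.coeff_toLaurent_dvd α β γ F₁ (k + -((n + k : ℕ) : ℤ)) k k n).1
    (by push_cast; omega)
  obtain ⟨g₂, h₂⟩ := (SixVarRing.coeff_toLaurent_dvd α β γ F₂ k (k + -((n + k : ℕ) : ℤ)) k n).2.1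
    (by push_cast; omega)
  obtain ⟨g₃, h₃⟩ := (SixVarRing.coeff_toLaurent_dvd α β γ F₃ k k (k + -((n + k : ℕ) : ℤ)) n).2.2
    (by push_cast; omega)
  exact ⟨g₁, g₂, g₃, by rw [← h₁, ← h₂, ← h₃]; exact hc'.symm⟩

theorem prime_mul_coeff_toLaurent {α β γ : T} (h : α + β + γ = 0) {p : ℕ} {l : HypersurfaceRing}
    (hl : (p : HypersurfaceRing) * l = (u * x) ^ p + (v * y) ^ p + (w * z) ^ p) :
    (p : T) * (toLaurent h l).coeff 0 = α ^ p + β ^ p + γ ^ p := by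
  have hu : toLaurent h (u * x) = single 0 α := by
    rw [map_mul, u, x, toLaurent_coord, toLaurent_coord]
    simp [laurentVar, single_mul_single]
    rfl
  have hv : toLaurent h (v * y) = single 0 β := by
    rw [map_mul, v, y, toLaurent_coord, toLaurent_coord]
    simp [laurentVar, single_mul_single]
    rfl
  have hw : toLaurent h (w * z) = single 0 γ := by
    rw [map_mul, w, z, toLaurent_coord, toLaurent_coord]
    simp [laurentVar, single_mul_single]
    rfl
  have hl' := congrArg (fun r => (toLaurent h r).coeff 0) hl
  rw [map_mul, map_natCast, ← nsmul_eq_mul, coeff_smul, Finsupp.smul_apply, nsmul_eq_mul] at hl'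
  simpa [hu, hv, hw, single_pow] using hl'

end Laurent

theorem xyz_pow_mul_notMem {p : ℕ} (hp : p.Prime) {l : HypersurfaceRing}
    (hl : (p : HypersurfaceRing) * l = (u * x) ^ p + (v * y) ^ p + (w * z) ^ p) (k : ℕ) :
    (x * y * z) ^ k * l ∉ ThreePowers.powIdeal x y z (p + k) := by
  intro hmem
  -- The choice `β = ε` makes `β^p` vanish, since `p ≥ 2`, while `γ^p` keeps the `ε`-part `± p
  -- X^(p-1)`.
  have h : (TrivSqZeroExt.inl Polynomial.X : DualNumber (Polynomial ℤ)) + DualNumber.eps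
      + -(TrivSqZeroExt.inl Polynomial.X + DualNumber.eps) = 0 := by ring
  obtain ⟨g₁, g₂, g₃, hg⟩ := coeff_toLaurent_mem h p k l hmem
  have hG := prime_mul_coeff_toLaurent h hl
  generalize (toLaurent h l).coeff 0 = G at hg hG
  have heps : (DualNumber.eps : DualNumber (Polynomial ℤ)) ^ p = 0 := by
    obtain ⟨m, rfl⟩ := Nat.exists_eq_add_of_le hp.two_le
    rw [pow_add, pow_two, DualNumber.eps_mul_eps, zero_mul]
  rw [heps] at hg hG
  obtain ⟨m, rfl⟩ := Nat.exists_eq_succ_of_ne_zero hp.ne_zero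
  rw [neg_pow] at hg hG
  have hG1 := congrArg TrivSqZeroExt.snd hG
  have hg1 := congrArg TrivSqZeroExt.snd hg
  rw [← nsmul_eq_mul] at hG1
  have hneg : ∀ q : ℕ, ((-1) ^ q : DualNumber (Polynomial ℤ)) = TrivSqZeroExt.inl ((-1) ^ q) := by
    intro q
    rw [← TrivSqZeroExt.inl_pow, TrivSqZeroExt.inl_neg, TrivSqZeroExt.inl_one]
  rw [hneg] at hG1 hg1
  simp at hG1 hg1
  have hm : ((m : Polynomial ℤ) + 1) ≠ 0 := by exact_mod_cast m.succ_ne_zero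
  have hXm : (Polynomial.X : Polynomial ℤ) ^ m ≠ 0 := pow_ne_zero _ Polynomial.X_ne_zero
  -- With `p = m + 1`, the `ε`-parts of the membership and of the formula for `pG` are combined and
  -- `p X^(p-1)` is cancelled. Setting `X = 0` then shows that `p` divides `±1`.
  have key : Polynomial.X * (g₁.snd + (-1) ^ (m + 1) * g₃.snd) +
      ((m : Polynomial ℤ) + 1) * ((-1) ^ (m + 1) * g₃.fst) = (-1) ^ (m + 1) := by
    refine mul_left_cancel₀ hm (mul_left_cancel₀ hXm ?_)
    rw [hg1] at hG1
    linear_combination hG1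
  have key' := congrArg (Polynomial.eval 0) key
  simp only [Polynomial.eval_add, Polynomial.eval_mul, Polynomial.eval_X, zero_mul, zero_add,
    Polynomial.eval_natCast, Polynomial.eval_one, Polynomial.eval_pow, Polynomial.eval_neg] at key'
  have hunit : IsUnit ((m : ℤ) + 1) :=
    isUnit_of_dvd_unit ⟨_, key'.symm⟩ ((isUnit_one.neg).pow (m + 1))
  rw [Int.isUnit_iff] at hunit
  have := hp.two_le
  omega

/-! ### Torsion classes and associated primes -/

/-- The classes in the direct limit are killed by `p`. -/
theorem prime_smul_cls_eq_zero {p : ℕ} {l : HypersurfaceRing}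
    (hl : (p : HypersurfaceRing) * l = (u * x) ^ p + (v * y) ^ p + (w * z) ^ p) :
    (p : HypersurfaceRing) • ThreePowers.cls x y z p l = 0 := by
  rw [ThreePowers.cls, ← map_smul, ← Submodule.Quotient.mk_smul, smul_eq_mul, hl,
    (Submodule.Quotient.mk_eq_zero _).2, map_zero]
  refine add_mem (add_mem ?_ ?_) ?_ <;> rw [mul_pow] <;>
    exact Ideal.mul_mem_left _ _ (Ideal.subset_span (by simp))

theorem cls_ne_zero {p : ℕ} (hp : p.Prime) {l : HypersurfaceRing}
    (hl : (p : HypersurfaceRing) * l = (u * x) ^ p + (v * y) ^ p + (w * z) ^ p) :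
    ThreePowers.cls x y z p l ≠ 0 := by
  intro h
  obtain ⟨j, hj, hjl⟩ := Module.DirectLimit.of.zero_exact h
  obtain ⟨k, rfl⟩ := Nat.exists_eq_add_of_le hj
  rw [ThreePowers.transition, Submodule.mapQ_apply, Submodule.Quotient.mk_eq_zero] at hjl
  refine xyz_pow_mul_notMem hp hl k ?_
  simpa using hjl

/-- The annihilator of a nonzero `p`-torsion element contains `p` and, `A` being Noetherian, lies in
an associated prime. Distinct prime numbers generate the unit ideal, so they get distinct associated
primes. -/
theorem associatedPrimes_infinite_of_prime_torsion {M : Type*} [AddCommGroup M]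
    {A : Type*} [CommRing A] [IsNoetherianRing A] [Module A M]
    (h : ∀ p : ℕ, p.Prime → ∃ m : M, m ≠ 0 ∧ (p : A) • m = 0) :
    (associatedPrimes A M).Infinite := by
  have key : ∀ p : Nat.Primes, ∃ P ∈ associatedPrimes A M, ((p : ℕ) : A) ∈ P := by
    intro p
    obtain ⟨m, hm, hpm⟩ := h p p.2
    obtain ⟨P, hP, hle⟩ := exists_le_isAssociatedPrime_of_isNoetherianRing A m hm
    exact ⟨P, hP, hle (Submodule.mem_colon_singleton.2 (by simpa using hpm))⟩
  choose f hf hpf using key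
  refine Set.infinite_of_injective_forall_mem (f := f) ?_ hf
  intro p q hpq
  by_contra hne
  have hcop : IsCoprime ((p : ℕ) : ℤ) ((q : ℕ) : ℤ) :=
    Nat.isCoprime_iff_coprime.2 ((Nat.coprime_primes p.2 q.2).2 fun h => hne (Subtype.ext h))
  obtain ⟨a, b, hab⟩ := hcop.map (Int.castRingHom A)
  have hprime : (f p).IsPrime := (hf p).isPrime
  refine hprime.ne_top ((Ideal.eq_top_iff_one _).2 ?_)
  rw [← hab]
  simp only [eq_intCast, Int.cast_natCast]
  exact add_mem (Ideal.mul_mem_left _ _ (hpf p)) (Ideal.mul_mem_left _ _ (hpq ▸ hpf q))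

end HypersurfaceRing

/-! ### Ext classes as cocycles on a projective resolution -/

section LocalCohomology

open CategoryTheory Opposite Limits

universe u

namespace CategoryTheory.ProjectiveResolution

section Represents

variable {R : Type u} [CommRing R]

variable {X X' : ModuleCat.{u} R} (P : ProjectiveResolution X) (P' : ProjectiveResolution X')
  (Y : ModuleCat.{u} R)

/-- The cochain complex of the morphisms from a resolution to `Y`. -/
noncomputable abbrev homComplex : CochainComplex (ModuleCat.{u} R) ℕ :=
  P.complex.linearYonedaObj R Y

/-- The map induced on `Hom(-, Y)` by a morphism of chain complexes. -/
noncomputable def linearYonedaObjMap {P P' : ChainComplex (ModuleCat.{u} R) ℕ} (φ : P ⟶ P')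
    (Y : ModuleCat.{u} R) : P'.linearYonedaObj R Y ⟶ P.linearYonedaObj R Y :=
  (HomologicalComplex.unopFunctor _ _).map
    ((((linearYoneda R (ModuleCat.{u} R)).obj Y).rightOp.mapHomologicalComplex _).map φ).op

/-- `Ext` in its first variable comes from a left derived functor with values in an opposite
category; this isolates the passage of its naturality squares through `unop`. -/
theorem _root_.CategoryTheory.unop_naturality_of_naturality {C : Type*} [Category* C]
    {A B E F : Cᵒᵖ} {G H : C}
    {a : A ⟶ B} {e : A ≅ E} {e' : B ≅ F} {b : E ⟶ F} (h : e.inv ≫ a = b ≫ e'.inv)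
    {i : E ≅ op G} {i' : F ≅ op H} {t : H ⟶ G} (h' : b ≫ i'.hom = i.hom ≫ t.op) :
    a.unop ≫ e.inv.unop ≫ i.inv.unop = (e'.inv.unop ≫ i'.inv.unop) ≫ t := by
  apply Quiver.Hom.op_inj
  simp only [op_comp, Quiver.Hom.op_unop, Category.assoc]
  rw [h, Iso.inv_comp_eq, ← Category.assoc, ← Category.assoc, ← h']
  simp

theorem isoExt_hom_naturality (f : X ⟶ X') (φ : P.complex ⟶ P'.complex)
    (comm : φ.f 0 ≫ P'.π.f 0 = P.π.f 0 ≫ f) (n : ℕ) :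
    ((Ext R (ModuleCat.{u} R) n).map f.op).app Y ≫ (P.isoExt n Y).hom =
      (P'.isoExt (R := R) n Y).hom ≫
        HomologicalComplex.homologyMap (linearYonedaObjMap φ Y) n := by
  have h := isoLeftDerivedObj_inv_naturality f P P' φ comm
    ((linearYoneda R (ModuleCat.{u} R)).obj Y).rightOp n
  have h2 := HomologicalComplex.homologyOp_hom_naturality (linearYonedaObjMap φ Y) n
  exact unop_naturality_of_naturality h h2

lemma _root_.HomologicalComplex.moduleCat_homologyπ_surjective {R ι : Type*} [Ring R]
    {c : ComplexShape ι} (K : HomologicalComplex (ModuleCat.{u} R) c) (i : ι) :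
    Function.Surjective (K.homologyπ i) :=
  (ModuleCat.epi_iff_surjective _).1 inferInstance

/-- The class `ξ` of `Extⁿ(X, Y)` is represented by the cocycle `f` on the resolution `P`. -/
def Represents {n : ℕ} (ξ : ((Ext R (ModuleCat.{u} R) n).obj (op X)).obj Y)
    (f : P.complex.X n ⟶ Y) : Prop :=
  ∃ c : (P.homComplex Y).cycles n,
    (P.homComplex Y).iCycles n c = f ∧
      (P.homComplex Y).homologyπ n c = (P.isoExt n Y).hom ξ

variable {P P' Y} {n : ℕ}

theorem exists_represents (ξ : ((Ext R (ModuleCat.{u} R) n).obj (op X)).obj Y) :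
    ∃ f, P.Represents Y ξ f := by
  obtain ⟨c, hc⟩ := HomologicalComplex.moduleCat_homologyπ_surjective _ n ((P.isoExt n Y).hom ξ)
  exact ⟨_, c, rfl, hc⟩

theorem Represents.d_comp {ξ : ((Ext R (ModuleCat.{u} R) n).obj (op X)).obj Y}
    {f : P.complex.X n ⟶ Y}
    (h : P.Represents Y ξ f) : P.complex.d (n + 1) n ≫ f = 0 := by
  obtain ⟨c, rfl, -⟩ := h
  exact ConcreteCategory.congr_hom ((P.homComplex Y).iCycles_d n (n + 1)) c

theorem exists_represented {f : P.complex.X n ⟶ Y} (hf : P.complex.d (n + 1) n ≫ f = 0) :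
    ∃ ξ, P.Represents Y ξ f := by
  -- `liftCycles` takes morphisms, so the element `f` is encoded as the morphism from `R` with `1 ↦
  -- f`.
  let g : ModuleCat.of R R ⟶ (P.homComplex Y).X n :=
    ModuleCat.ofHom (LinearMap.toSpanSingleton R (P.complex.X n ⟶ Y) f)
  have hg : g ≫ (P.homComplex Y).d n (n + 1) = 0 := by
    ext
    exact (congrArg (P.complex.d (n + 1) n ≫ ·) (one_smul R f)).trans hf
  refine ⟨(P.isoExt n Y).inv ((P.homComplex Y).homologyπ n
    ((P.homComplex Y).liftCycles g (n + 1) (by simp) hg (1 : R))),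
    (P.homComplex Y).liftCycles g (n + 1) (by simp) hg (1 : R), ?_, ?_⟩
  · refine (ConcreteCategory.congr_hom
      ((P.homComplex Y).liftCycles_i g (n + 1) (by simp) hg) (1 : R)).trans ?_
    exact one_smul R f
  · simp

theorem Represents.add {ξ ξ' : ((Ext R (ModuleCat.{u} R) n).obj (op X)).obj Y}
    {f f' : P.complex.X n ⟶ Y}
    (h : P.Represents Y ξ f) (h' : P.Represents Y ξ' f') : P.Represents Y (ξ + ξ') (f + f') := by
  obtain ⟨c, rfl, hc⟩ := h
  obtain ⟨c', rfl, hc'⟩ := h'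
  exact ⟨c + c', map_add _ _ _, by rw [map_add, map_add, hc, hc']⟩

theorem Represents.smul {ξ : ((Ext R (ModuleCat.{u} R) n).obj (op X)).obj Y}
    {f : P.complex.X n ⟶ Y}
    (h : P.Represents Y ξ f) (r : R) : P.Represents Y (r • ξ) (r • f) := by
  obtain ⟨c, rfl, hc⟩ := h
  exact ⟨r • c, map_smul _ _ _, by rw [map_smul, map_smul, hc]⟩

theorem Represents.map {ξ : ((Ext R (ModuleCat.{u} R) n).obj (op X')).obj Y}
    {f : P'.complex.X n ⟶ Y}
    (h : P'.Represents Y ξ f) {g : X ⟶ X'} (φ : P.complex ⟶ P'.complex)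
    (comm : φ.f 0 ≫ P'.π.f 0 = P.π.f 0 ≫ g) :
    P.Represents Y (((Ext R (ModuleCat.{u} R) n).map g.op).app Y ξ) (φ.f n ≫ f) := by
  obtain ⟨c, rfl, hc⟩ := h
  refine ⟨HomologicalComplex.cyclesMap (linearYonedaObjMap φ Y) n c, ?_, ?_⟩
  · exact ConcreteCategory.congr_hom (HomologicalComplex.cyclesMap_i (linearYonedaObjMap φ Y) n) c
  · refine (ConcreteCategory.congr_hom
      (HomologicalComplex.homologyπ_naturality (linearYonedaObjMap φ Y) n) c).symm.trans ?_
    refine (congrArg _ hc).trans ?_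
    exact (ConcreteCategory.congr_hom (isoExt_hom_naturality P P' Y g φ comm n) ξ).symm

theorem Represents.eq_zero_iff {ξ : ((Ext R (ModuleCat.{u} R) (n + 1)).obj (op X)).obj Y}
    {f : P.complex.X (n + 1) ⟶ Y}
    (h : P.Represents Y ξ f) : ξ = 0 ↔ ∃ g, P.complex.d (n + 1) n ≫ g = f := by
  obtain ⟨c, rfl, hc⟩ := h
  have h1 : ξ = 0 ↔ (P.homComplex Y).homologyπ (n + 1) c = 0 := by
    rw [hc]
    constructor
    · rintro rfl; exact map_zero _
    · intro h
      have := congrArg (P.isoExt (n + 1) Y).inv h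
      simpa using this
  rw [h1]
  have hex : (ShortComplex.mk _ _ ((P.homComplex Y).toCycles_comp_homologyπ n (n + 1))).Exact :=
    ShortComplex.exact_of_g_is_cokernel _ ((P.homComplex Y).homologyIsCokernel n (n + 1) (by simp))
  have hinj : Function.Injective ((P.homComplex Y).iCycles (n + 1)) :=
    (ModuleCat.mono_iff_injective _).1 inferInstance
  constructor
  · intro h
    obtain ⟨g, rfl⟩ := (ShortComplex.moduleCat_exact_iff _).1 hex c h
    exact ⟨g, (ConcreteCategory.congr_hom ((P.homComplex Y).toCycles_i n (n + 1)) g).symm⟩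
  · rintro ⟨g, hg⟩
    have : (P.homComplex Y).toCycles n (n + 1) g = c := by
      apply hinj
      rw [← hg]
      exact ConcreteCategory.congr_hom ((P.homComplex Y).toCycles_i n (n + 1)) g
    rw [← this]
    exact ConcreteCategory.congr_hom ((P.homComplex Y).toCycles_comp_homologyπ n (n + 1)) g

end Represents

end CategoryTheory.ProjectiveResolution

/-! ### Lifting along exact complexes -/

section Lifting

variable {A : Type*} [CommRing A]

/-- A map from a projective module into the image of `d` lifts along `d`. -/
theorem Module.Projective.exists_comp_eq_of_range_le {F M N : Type*} [AddCommGroup F] [Module A F]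
    [AddCommGroup M] [Module A M] [AddCommGroup N] [Module A N] [Module.Projective A F]
    (d : M →ₗ[A] N) (g : F →ₗ[A] N) (h : ∀ m, ∃ m', d m' = g m) :
    ∃ g' : F →ₗ[A] M, d ∘ₗ g' = g := by
  obtain ⟨g', hg'⟩ := Module.projective_lifting_property d.rangeRestrict
    (g.codRestrict (LinearMap.range d) h) d.surjective_rangeRestrict
  refine ⟨g', LinearMap.ext fun m => ?_⟩
  exact congrArg Subtype.val (LinearMap.congr_fun hg' m)

/-- The part of a null-homotopy of a morphism of complexes that reaches degree `2`. -/
theorem Module.Projective.exists_homotopy {F₀ F₁ F₂ F₃ C₁ C₂ C₃ : Type*}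
    [AddCommGroup F₀] [Module A F₀] [AddCommGroup F₁] [Module A F₁]
    [AddCommGroup F₂] [Module A F₂] [AddCommGroup F₃] [Module A F₃]
    [AddCommGroup C₁] [Module A C₁]
    [AddCommGroup C₂] [Module A C₂] [AddCommGroup C₃] [Module A C₃]
    [Module.Projective A F₁] [Module.Projective A F₂]
    {e₁ : F₁ →ₗ[A] F₀} {e₂ : F₂ →ₗ[A] F₁} {e₃ : F₃ →ₗ[A] F₂}
    (he₂ : e₁ ∘ₗ e₂ = 0) (he₃ : e₂ ∘ₗ e₃ = 0)
    {d₂ : C₂ →ₗ[A] C₁} {d₃ : C₃ →ₗ[A] C₂}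
    (hd₃ : ∀ m, d₂ m = 0 → ∃ m', d₃ m' = m)
    {s₁ : F₁ →ₗ[A] C₁} {s₂ : F₂ →ₗ[A] C₂} {s₃ : F₃ →ₗ[A] C₃}
    (hs₂ : d₂ ∘ₗ s₂ = s₁ ∘ₗ e₂) (hs₃ : d₃ ∘ₗ s₃ = s₂ ∘ₗ e₃)
    (h₀ : F₀ →ₗ[A] C₁) (hh : ∀ m, ∃ m', d₂ m' = s₁ m - h₀ (e₁ m)) :
    ∃ h₂ : F₂ →ₗ[A] C₃, ∀ m, d₃ (s₃ m - h₂ (e₃ m)) = 0 := by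
  -- The homotopy starts from `hh` instead of exactness at `C₁`, because in
  -- `IsProExact.exists_represents` the target is a Koszul complex that may fail to be exact there.
  obtain ⟨h₁, hh₁⟩ := Module.Projective.exists_comp_eq_of_range_le d₂ (s₁ - h₀ ∘ₗ e₁) hh
  obtain ⟨h₂, hh₂⟩ := Module.Projective.exists_comp_eq_of_range_le d₃ (s₂ - h₁ ∘ₗ e₂) fun m => by
    refine hd₃ _ ?_
    have e1 := LinearMap.congr_fun hs₂ m
    have e2 := LinearMap.congr_fun hh₁ (e₂ m)
    have e3 := LinearMap.congr_fun he₂ m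
    simp only [LinearMap.comp_apply, LinearMap.sub_apply, LinearMap.zero_apply, map_sub] at *
    rw [e1, e2, e3, map_zero, sub_zero, sub_self]
  refine ⟨h₂, fun m => ?_⟩
  have e1 := LinearMap.congr_fun hs₃ m
  have e2 := LinearMap.congr_fun hh₂ (e₃ m)
  have e3 := LinearMap.congr_fun he₃ m
  simp only [LinearMap.comp_apply, LinearMap.sub_apply, LinearMap.zero_apply, map_sub] at *
  rw [e1, e2, e3, map_zero, sub_zero, sub_self]

end Lifting

/-! ### Koszul complexes on three elements and pro-exactness -/

namespace ThreeKoszul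

variable {A : Type*} [CommRing A]

/-- The differential of degree `1` of the Koszul complex of `a, b, c`. -/
def d₁ (a b c : A) : (A × A × A) →ₗ[A] A where
  toFun m := a * m.1 + b * m.2.1 + c * m.2.2
  map_add' m m' := by simp only [Prod.fst_add, Prod.snd_add]; ring
  map_smul' r m := by simp only [Prod.smul_fst, Prod.smul_snd, smul_eq_mul, RingHom.id_apply]; ring

/-- The differential of degree `2` of the Koszul complex of `a, b, c`. -/
def d₂ (a b c : A) : (A × A × A) →ₗ[A] (A × A × A) where
  toFun m := (-(c * m.2.1) - b * m.2.2, a * m.2.2 - c * m.1, b * m.1 + a * m.2.1)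
  map_add' m m' := by
    simp only [Prod.fst_add, Prod.snd_add, Prod.mk_add_mk, Prod.mk.injEq]
    refine ⟨?_, ?_, ?_⟩ <;> ring
  map_smul' r m := by
    simp only [Prod.smul_fst, Prod.smul_snd, smul_eq_mul, RingHom.id_apply, Prod.smul_mk,
      Prod.mk.injEq]
    refine ⟨?_, ?_, ?_⟩ <;> ring

/-- The differential of degree `3` of the Koszul complex of `a, b, c`. -/
def d₃ (a b c : A) : A →ₗ[A] (A × A × A) :=
  LinearMap.toSpanSingleton A (A × A × A) (a, -b, c)

theorem d₁_apply (a b c p q r : A) : d₁ a b c (p, q, r) = a * p + b * q + c * r := rfl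

theorem d₂_apply (a b c p q r : A) :
    d₂ a b c (p, q, r) = (-(c * q) - b * r, a * r - c * p, b * p + a * q) := rfl

theorem d₃_apply (a b c s : A) : d₃ a b c s = (s * a, s * -b, s * c) := rfl

theorem d₁_comp_d₂ (a b c : A) : d₁ a b c ∘ₗ d₂ a b c = 0 := by
  refine LinearMap.ext fun ⟨p, q, r⟩ => ?_
  rw [LinearMap.comp_apply, d₂_apply, d₁_apply, LinearMap.zero_apply]
  ring

theorem d₂_comp_d₃ (a b c : A) : d₂ a b c ∘ₗ d₃ a b c = 0 := by
  refine LinearMap.ext fun s => ?_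
  rw [LinearMap.comp_apply, d₃_apply, d₂_apply, LinearMap.zero_apply, Prod.mk_eq_zero,
    Prod.mk_eq_zero]
  refine ⟨?_, ?_, ?_⟩ <;> ring

theorem exists_d₁_eq_iff (a b c r : A) :
    (∃ m, d₁ a b c m = r) ↔ r ∈ Ideal.span {a, b, c} := by
  rw [Ideal.span, Submodule.mem_span_triple]
  constructor
  · rintro ⟨⟨p, q, s⟩, rfl⟩
    exact ⟨p, q, s, by simp only [d₁_apply, smul_eq_mul]; ring⟩
  · rintro ⟨p, q, s, rfl⟩
    exact ⟨(p, q, s), by simp only [d₁_apply, smul_eq_mul]; ring⟩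

/-- The functionals on the term of degree `2` take on the image of `1` all values in the ideal. -/
theorem exists_apply_d₃_one_iff (a b c r : A) :
    (∃ g : (A × A × A) →ₗ[A] A, g (d₃ a b c 1) = r) ↔ r ∈ Ideal.span {a, b, c} := by
  constructor
  · rintro ⟨g, rfl⟩
    have : d₃ a b c 1 = a • (1, 0, 0) + (-b) • (0, 1, 0) + c • (0, 0, 1) := by
      simp [d₃_apply]
    rw [this, map_add, map_add, map_smul, map_smul, map_smul]
    refine add_mem (add_mem ?_ ?_) ?_ <;> rw [smul_eq_mul]
    · exact Ideal.mul_mem_right _ _ (Ideal.subset_span (by simp))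
    · exact Ideal.mul_mem_right _ _ (neg_mem (Ideal.subset_span (by simp)))
    · exact Ideal.mul_mem_right _ _ (Ideal.subset_span (by simp))
  · rw [Ideal.span, Submodule.mem_span_triple]
    rintro ⟨p, q, s, rfl⟩
    refine ⟨d₁ p (-q) s, ?_⟩
    simp only [d₃_apply, d₁_apply, smul_eq_mul]
    ring

/-- The term of degree `1` of the morphism from the Koszul complex of `aα, bβ, cγ` to that
of `a, b, c`. -/
def t₁ (α β γ : A) : (A × A × A) →ₗ[A] (A × A × A) :=
  (LinearMap.mulLeft A α).prodMap ((LinearMap.mulLeft A β).prodMap (LinearMap.mulLeft A γ))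

/-- The term of degree `2` of the same morphism. -/
def t₂ (α β γ : A) : (A × A × A) →ₗ[A] (A × A × A) := t₁ (β * γ) (α * γ) (α * β)

/-- The term of degree `3` of the same morphism. -/
def t₃ (α β γ : A) : A →ₗ[A] A := LinearMap.mulLeft A (α * β * γ)

theorem t₁_apply (α β γ p q r : A) : t₁ α β γ (p, q, r) = (α * p, β * q, γ * r) := rfl

theorem d₁_comp_t₁ (a b c α β γ : A) :
    d₁ a b c ∘ₗ t₁ α β γ = d₁ (a * α) (b * β) (c * γ) := by
  refine LinearMap.ext fun ⟨p, q, r⟩ => ?_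
  rw [LinearMap.comp_apply, t₁_apply, d₁_apply, d₁_apply]
  ring

theorem d₂_comp_t₂ (a b c α β γ : A) :
    d₂ a b c ∘ₗ t₂ α β γ = t₁ α β γ ∘ₗ d₂ (a * α) (b * β) (c * γ) := by
  refine LinearMap.ext fun ⟨p, q, r⟩ => ?_
  rw [LinearMap.comp_apply, LinearMap.comp_apply, t₂, t₁_apply, d₂_apply, d₂_apply, t₁_apply,
    Prod.mk.injEq, Prod.mk.injEq]
  refine ⟨?_, ?_, ?_⟩ <;> ring

theorem d₃_comp_t₃ (a b c α β γ : A) :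
    d₃ a b c ∘ₗ t₃ α β γ = t₂ α β γ ∘ₗ d₃ (a * α) (b * β) (c * γ) := by
  refine LinearMap.ext fun s => ?_
  rw [LinearMap.comp_apply, LinearMap.comp_apply, t₃, LinearMap.mulLeft_apply, t₂, d₃_apply,
    d₃_apply, t₁_apply, Prod.mk.injEq, Prod.mk.injEq]
  refine ⟨?_, ?_, ?_⟩ <;> ring

/-- The Koszul complex of `a, b, c` is exact in degrees `3` and `2`, and the transition morphism
from the Koszul complex of `aα, bβ, cγ` kills the homology in degree `1`. -/
structure IsProExact (a b c α β γ : A) : Prop where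
  eq_zero : ∀ s, d₃ a b c s = 0 → s = 0
  exact₂ : ∀ m, d₂ a b c m = 0 → ∃ s, d₃ a b c s = m
  exact₁ : ∀ m, d₁ (a * α) (b * β) (c * γ) m = 0 → ∃ m', d₂ a b c m' = t₁ α β γ m

/-- The last coordinate of the cycle condition is `bp + aq = 0`, so `p = as`. Regularity of `a` then
determines `q` and `r` from `s`. -/
theorem exact₂_of_regular {a b : A} (c : A) (ha : ∀ s, a * s = 0 → s = 0)
    (hb : ∀ s, a ∣ b * s → a ∣ s) (m : A × A × A) (hm : d₂ a b c m = 0) :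
    ∃ s, d₃ a b c s = m := by
  obtain ⟨p, q, r⟩ := m
  rw [d₂_apply, Prod.mk_eq_zero, Prod.mk_eq_zero] at hm
  obtain ⟨h1, h2, h3⟩ := hm
  obtain ⟨s, rfl⟩ := hb p ⟨-q, by linear_combination h3⟩
  refine ⟨s, ?_⟩
  have h4 : q + b * s = 0 := ha _ (by linear_combination h3)
  have h5 : r - c * s = 0 := ha _ (by linear_combination h2)
  rw [d₃_apply, Prod.mk.injEq, Prod.mk.injEq]
  refine ⟨by ring, by linear_combination -h4, by linear_combination -h5⟩

/-- Subtracting a boundary clears the last coordinate; what remains is a syzygy of the regular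
sequence `a, b`. The condition on `r` is the only obstruction in degree `1`. -/
theorem exists_d₂_eq_of_regular {a b c p q r : A} (ha : ∀ s, a * s = 0 → s = 0)
    (hb : ∀ s, a ∣ b * s → a ∣ s) (h : d₁ a b c (p, q, r) = 0) (hr : r ∈ Ideal.span {a, b}) :
    ∃ m, d₂ a b c m = (p, q, r) := by
  obtain ⟨q', p', rfl⟩ := Ideal.mem_span_pair.1 hr
  rw [d₁_apply] at h
  obtain ⟨s, hs⟩ := hb (q + c * p') ⟨-(p + c * q'), by linear_combination h⟩
  have h4 : p + c * q' + b * s = 0 := ha _ (by linear_combination h - b * hs)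
  refine ⟨(p', q', s), ?_⟩
  rw [d₂_apply, Prod.mk.injEq, Prod.mk.injEq]
  refine ⟨by linear_combination -h4, by linear_combination -hs, by ring⟩

theorem pow_regular {a : A} (ha : ∀ s, a * s = 0 → s = 0) (n : ℕ) (s : A) (h : a ^ n * s = 0) :
    s = 0 := by
  induction n with
  | zero => simpa using h
  | succ n ih => exact ih (ha _ (by rw [← h]; ring))

theorem pow_regular_mod_pow {a b : A} (ha : ∀ s, a * s = 0 → s = 0)
    (hb : ∀ s, a ∣ b * s → a ∣ s) (m n : ℕ) (s : A) (h : a ^ m ∣ b ^ n * s) : a ^ m ∣ s := by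
  have h1 : ∀ m s, a ^ m ∣ b * s → a ^ m ∣ s := by
    intro m
    induction m with
    | zero => simp
    | succ m ih =>
      intro s hs
      obtain ⟨s', rfl⟩ := ih s ((pow_dvd_pow a m.le_succ).trans hs)
      obtain ⟨r, hr⟩ := hs
      obtain ⟨s'', rfl⟩ := hb s' ⟨r, by
        refine sub_eq_zero.1 (pow_regular ha m _ ?_)
        linear_combination hr⟩
      exact ⟨s'', by ring⟩
  induction n with
  | zero => simpa using h
  | succ n ih => exact ih (h1 m _ (by rwa [pow_succ', mul_assoc] at h))

/-- If `a, b` is a regular sequence in a Noetherian ring, then the Koszul complexes of the powers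
of `a, b, c` are pro-exact. -/
theorem exists_isProExact [IsNoetherianRing A] {a b : A} (c : A) (ha : ∀ s, a * s = 0 → s = 0)
    (hb : ∀ s, a ∣ b * s → a ∣ s) (n : ℕ) :
    ∃ e : ℕ, IsProExact (a ^ n) (b ^ n) (c ^ n) (a ^ e) (b ^ e) (c ^ e) := by
  have ha' := pow_regular ha n
  have hb' := pow_regular_mod_pow ha hb n n
  let I : Ideal A := Ideal.span {a ^ n, b ^ n}
  -- The colon ideals `(I : c^k)` ascend, and an index `e` where they stabilize is the exponent of
  -- the transition. A cycle has `c^n r ∈ I` up to the twist by `e`, that is `c^(n+e) r ∈ I`, and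
  -- stability improves this to `c^e r ∈ I`.
  let Q : ℕ →o Ideal A :=
    ⟨fun k => Submodule.comap (LinearMap.mulLeft A (c ^ k)) I, fun k k' hk r hr => by
      obtain ⟨l, rfl⟩ := Nat.exists_eq_add_of_le hk
      have := Ideal.mul_mem_left I (c ^ l) hr
      simpa [pow_add, mul_assoc, mul_left_comm, mul_comm] using this⟩
  obtain ⟨e, he⟩ := monotone_stabilizes_iff_noetherian.2 ‹IsNoetherianRing A› Q
  refine ⟨e, ?_, exact₂_of_regular _ ha' hb', ?_⟩
  · intro s hs
    rw [d₃_apply, Prod.mk_eq_zero] at hs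
    exact ha' s (by rw [mul_comm]; exact hs.1)
  · rintro ⟨p, q, r⟩ h
    rw [t₁_apply]
    refine exists_d₂_eq_of_regular ha' hb' ?_ ?_
    · rw [← d₁_comp_t₁] at h
      exact h
    · change r ∈ Q e
      rw [he (n + e) (Nat.le_add_left e n)]
      change c ^ (n + e) * r ∈ I
      rw [d₁_apply] at h
      refine Ideal.mem_span_pair.2 ⟨-(a ^ e * p), -(b ^ e * q), ?_⟩
      rw [pow_add]
      linear_combination -h

end ThreeKoszul

/-! ### Projective resolutions in terms of linear maps -/

namespace CategoryTheory.ProjectiveResolution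

variable {A : Type u} [CommRing A] {X : ModuleCat.{u} A} (P : ProjectiveResolution X)

instance moduleProjective (n : ℕ) : Module.Projective A (P.complex.X n) :=
  (IsProjective.iff_projective (P.complex.X n)).2 (P.projective n)

/-- The differential of a resolution, as a linear map. -/
def dLin (i j : ℕ) : P.complex.X i →ₗ[A] P.complex.X j := (P.complex.d i j).hom

/-- The augmentation of a resolution, as a linear map. -/
def aug : P.complex.X 0 →ₗ[A] X := ModuleCat.Hom.hom (B := X) (P.π.f 0)

theorem aug_surjective : Function.Surjective P.aug :=
  (ModuleCat.epi_iff_surjective (P.π.f 0)).1 inferInstance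

theorem aug_comp_dLin : P.aug ∘ₗ P.dLin 1 0 = 0 :=
  congrArg ModuleCat.Hom.hom P.complex_d_comp_π_f_zero

theorem dLin_comp_dLin (n : ℕ) : P.dLin (n + 1) n ∘ₗ P.dLin (n + 2) (n + 1) = 0 :=
  congrArg ModuleCat.Hom.hom (P.complex.d_comp_d (n + 2) (n + 1) n)

theorem exists_dLin_eq_of_aug_eq_zero (m : P.complex.X 0) (h : P.aug m = 0) :
    ∃ m', P.dLin 1 0 m' = m :=
  (ShortComplex.moduleCat_exact_iff _).1 P.exact₀ m h

theorem exists_dLin_eq (n : ℕ) (m : P.complex.X (n + 1)) (h : P.dLin (n + 1) n m = 0) :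
    ∃ m', P.dLin (n + 2) (n + 1) m' = m :=
  (ShortComplex.moduleCat_exact_iff _).1 (P.exact_succ n) m h

end CategoryTheory.ProjectiveResolution

/-! ### Comparison of `Ext³` with Koszul cohomology -/

namespace ThreeKoszul

variable {A : Type u} [CommRing A] {a b c : A}

/-- The module `A / (a, b, c)`. -/
abbrev quot (a b c : A) : ModuleCat.{u} A := ModuleCat.of A (A ⧸ Ideal.span {a, b, c})

/-- A morphism from the Koszul complex to a projective resolution of `A / (a, b, c)` that is
compatible with the augmentations. -/
structure Comparison (P : ProjectiveResolution (quot a b c)) where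
  /-- The term of degree `0`. -/
  k₀ : A →ₗ[A] P.complex.X 0
  /-- The term of degree `1`. -/
  k₁ : (A × A × A) →ₗ[A] P.complex.X 1
  /-- The term of degree `2`. -/
  k₂ : (A × A × A) →ₗ[A] P.complex.X 2
  /-- The term of degree `3`. -/
  k₃ : A →ₗ[A] P.complex.X 3
  aug_k₀ : P.aug ∘ₗ k₀ = Submodule.mkQ _
  comm₁ : P.dLin 1 0 ∘ₗ k₁ = k₀ ∘ₗ d₁ a b c
  comm₂ : P.dLin 2 1 ∘ₗ k₂ = k₁ ∘ₗ d₂ a b c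
  comm₃ : P.dLin 3 2 ∘ₗ k₃ = k₂ ∘ₗ d₃ a b c

/-- The Koszul terms are free and the resolution is exact, so the lifts exist degree by degree; no
exactness of the Koszul complex is involved. -/
theorem nonempty_comparison (P : ProjectiveResolution (quot a b c)) : Nonempty (Comparison P) := by
  obtain ⟨k₀, h₀⟩ := Module.projective_lifting_property P.aug (Submodule.mkQ _) P.aug_surjective
  obtain ⟨k₁, h₁⟩ := Module.Projective.exists_comp_eq_of_range_le (P.dLin 1 0) (k₀ ∘ₗ d₁ a b c)
    fun m => by
      refine P.exists_dLin_eq_of_aug_eq_zero _ ((LinearMap.congr_fun h₀ (d₁ a b c m)).trans ?_)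
      exact (Submodule.Quotient.mk_eq_zero _).2 ((exists_d₁_eq_iff a b c _).1 ⟨m, rfl⟩)
  obtain ⟨k₂, h₂⟩ := Module.Projective.exists_comp_eq_of_range_le (P.dLin 2 1) (k₁ ∘ₗ d₂ a b c)
    fun m => by
      refine P.exists_dLin_eq 0 _ ((LinearMap.congr_fun h₁ (d₂ a b c m)).trans ?_)
      exact (congrArg k₀ (LinearMap.congr_fun (d₁_comp_d₂ a b c) m)).trans (map_zero _)
  obtain ⟨k₃, h₃⟩ := Module.Projective.exists_comp_eq_of_range_le (P.dLin 3 2) (k₂ ∘ₗ d₃ a b c)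
    fun m => by
      refine P.exists_dLin_eq 1 _ ((LinearMap.congr_fun h₂ (d₃ a b c m)).trans ?_)
      exact (congrArg k₁ (LinearMap.congr_fun (d₂_comp_d₃ a b c) m)).trans (map_zero _)
  exact ⟨⟨k₀, k₁, k₂, k₃, h₀, h₁, h₂, h₃⟩⟩

/-- `Ext³(X, A)`, for an `A`-module `X`. -/
noncomputable abbrev Ext3 (X : ModuleCat.{u} A) : ModuleCat.{u} A :=
  ((Ext A (ModuleCat.{u} A) 3).obj (op X)).obj (ModuleCat.of A A)

/-- The map induced on `Ext³(-, A)`. -/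
noncomputable abbrev Ext3.map {X X' : ModuleCat.{u} A} (g : X ⟶ X') : Ext3 X' ⟶ Ext3 X :=
  ((Ext A (ModuleCat.{u} A) 3).map g.op).app (ModuleCat.of A A)

/-- The map `Ext³(A / (a, b, c), A) → A / (a, b, c)` to the Koszul cohomology of degree `3`. -/
theorem Comparison.exists_toQuot {P : ProjectiveResolution (quot a b c)} (κ : Comparison P) :
    ∃ θ : Ext3 (quot a b c) →ₗ[A] A ⧸ Ideal.span {a, b, c},
      ∀ ξ f, P.Represents (ModuleCat.of A A) ξ f →
        θ ξ = Submodule.Quotient.mk (f.hom (κ.k₃ 1)) := by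
  -- Cocycles of the same class differ by a coboundary `g ∘ d`. Its value at `k₃ 1` is that of `g ∘
  -- k₂` at `d₃ 1`, which lies in the ideal.
  have key : ∀ ξ f f', P.Represents (ModuleCat.of A A) ξ f →
      P.Represents (ModuleCat.of A A) (n := 3) ξ f' →
      (Submodule.Quotient.mk (f.hom (κ.k₃ 1)) : A ⧸ Ideal.span {a, b, c}) =
        Submodule.Quotient.mk (f'.hom (κ.k₃ 1)) := by
    intro ξ f f' h h'
    have h0 : P.Represents (ModuleCat.of A A) (n := 3) 0 (f + (-1 : A) • f') := by
      have := h.add (h'.smul (-1))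
      rwa [neg_one_smul, add_neg_cancel] at this
    obtain ⟨g, hg⟩ := h0.eq_zero_iff.1 rfl
    rw [Submodule.Quotient.eq]
    refine (exists_apply_d₃_one_iff a b c _).1 ⟨g.hom ∘ₗ κ.k₂, ?_⟩
    have e1 := LinearMap.congr_fun κ.comm₃ 1
    have e2 := LinearMap.congr_fun (congrArg ModuleCat.Hom.hom hg) (κ.k₃ 1)
    refine (congrArg g.hom e1.symm).trans (e2.trans ?_)
    rw [ModuleCat.hom_add, ModuleCat.hom_smul, LinearMap.add_apply, LinearMap.smul_apply,
      neg_one_smul, sub_eq_add_neg]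
  choose F hF using fun ξ => P.exists_represents (Y := ModuleCat.of A A) (n := 3) ξ
  refine ⟨{ toFun ξ := Submodule.Quotient.mk ((F ξ).hom (κ.k₃ 1)), map_add' := ?_,
            map_smul' := ?_ }, fun ξ f h => key ξ _ _ (hF ξ) h⟩
  · intro ξ ξ'
    rw [key _ _ _ (hF (ξ + ξ')) ((hF ξ).add (hF ξ'))]
    rfl
  · intro r ξ
    rw [key _ _ _ (hF (r • ξ)) ((hF ξ).smul r)]
    rfl

/-- The comparison morphisms are compatible with the transition morphisms up to homotopy. -/
theorem Comparison.exists_apply_k₃_sub {α β γ : A} {P : ProjectiveResolution (quot a b c)}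
    {P' : ProjectiveResolution (quot (a * α) (b * β) (c * γ))} (κ : Comparison P)
    (κ' : Comparison P') {g : quot (a * α) (b * β) (c * γ) ⟶ quot a b c}
    (hg : ∀ r : A, g.hom (Submodule.Quotient.mk r) = Submodule.Quotient.mk r)
    (φ : P'.complex ⟶ P.complex) (comm : φ.f 0 ≫ P.π.f 0 = P'.π.f 0 ≫ g) :
    ∃ h₂ : (A × A × A) →ₗ[A] P.complex.X 3, P.dLin 3 2 ((φ.f 3).hom (κ'.k₃ 1)
        - κ.k₃ (α * β * γ) - h₂ (d₃ (a * α) (b * β) (c * γ) 1)) = 0 := by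
  have hφ : ∀ i j (m : P'.complex.X i),
      P.dLin i j ((φ.f i).hom m) = (φ.f j).hom (P'.dLin i j m) := fun i j m =>
    ConcreteCategory.congr_hom (φ.comm i j) m
  obtain ⟨h₀, hh₀⟩ := Module.Projective.exists_comp_eq_of_range_le (P.dLin 1 0)
    ((φ.f 0).hom ∘ₗ κ'.k₀ - κ.k₀) fun m => by
      refine P.exists_dLin_eq_of_aug_eq_zero _ ?_
      have e1 : P.aug ((φ.f 0).hom (κ'.k₀ m)) = g.hom (P'.aug (κ'.k₀ m)) :=
        ConcreteCategory.congr_hom comm (κ'.k₀ m)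
      have e2 := LinearMap.congr_fun κ'.aug_k₀ m
      have e3 := LinearMap.congr_fun κ.aug_k₀ m
      simp only [LinearMap.comp_apply, Submodule.mkQ_apply] at e2 e3
      rw [LinearMap.sub_apply, map_sub, LinearMap.comp_apply, e1, e2, e3, hg, sub_self]
  have c1 := fun m => LinearMap.congr_fun κ.comm₁ m
  have c2 := fun m => LinearMap.congr_fun κ.comm₂ m
  have c3 := fun m => LinearMap.congr_fun κ.comm₃ m
  have c1' := fun m => LinearMap.congr_fun κ'.comm₁ m
  have c2' := fun m => LinearMap.congr_fun κ'.comm₂ m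
  have c3' := fun m => LinearMap.congr_fun κ'.comm₃ m
  have u1 := fun m => LinearMap.congr_fun (d₁_comp_t₁ a b c α β γ) m
  have u2 := fun m => LinearMap.congr_fun (d₂_comp_t₂ a b c α β γ) m
  have u3 := fun m => LinearMap.congr_fun (d₃_comp_t₃ a b c α β γ) m
  simp only [LinearMap.comp_apply] at c1 c2 c3 c1' c2' c3' u1 u2 u3
  obtain ⟨h₂, hh₂⟩ := Module.Projective.exists_homotopy
    (d₁_comp_d₂ (a * α) (b * β) (c * γ)) (d₂_comp_d₃ (a * α) (b * β) (c * γ))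
    (d₂ := P.dLin 2 1) (d₃ := P.dLin 3 2) (P.exists_dLin_eq 1)
    (s₁ := (φ.f 1).hom ∘ₗ κ'.k₁ - κ.k₁ ∘ₗ t₁ α β γ)
    (s₂ := (φ.f 2).hom ∘ₗ κ'.k₂ - κ.k₂ ∘ₗ t₂ α β γ)
    (s₃ := (φ.f 3).hom ∘ₗ κ'.k₃ - κ.k₃ ∘ₗ t₃ α β γ)
    (by
      refine LinearMap.ext fun m => ?_
      simp only [LinearMap.comp_apply, LinearMap.sub_apply, map_sub, hφ, c2, c2', u2])
    (by
      refine LinearMap.ext fun m => ?_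
      simp only [LinearMap.comp_apply, LinearMap.sub_apply, map_sub, hφ, c3, c3', u3])
    h₀ (fun m => by
      refine P.exists_dLin_eq 0 _ ?_
      have e := LinearMap.congr_fun hh₀ (d₁ (a * α) (b * β) (c * γ) m)
      simp only [LinearMap.comp_apply, LinearMap.sub_apply, map_sub, hφ, c1, c1', u1] at e ⊢
      rw [e, sub_self])
  refine ⟨h₂, ?_⟩
  simpa only [LinearMap.sub_apply, LinearMap.comp_apply, t₃, LinearMap.mulLeft_apply, mul_one]
    using hh₂ 1

/-- Naturality of the map from `Ext³` to the Koszul cohomology. -/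
theorem Comparison.toQuot_map {a' b' c' α β γ : A} (ha : a' = a * α) (hb : b' = b * β)
    (hc : c' = c * γ) {P : ProjectiveResolution (quot a b c)}
    {P' : ProjectiveResolution (quot a' b' c')} (κ : Comparison P)
    (κ' : Comparison P') {g : quot a' b' c' ⟶ quot a b c}
    (hg : ∀ r : A, g.hom (Submodule.Quotient.mk r) = Submodule.Quotient.mk r)
    {ξ : Ext3 (quot a b c)} {f : P.complex.X 3 ⟶ ModuleCat.of A A}
    (hf : P.Represents (ModuleCat.of A A) (n := 3) ξ f) :
    ∃ f', P'.Represents (ModuleCat.of A A) (n := 3) (Ext3.map g ξ) f' ∧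
      f'.hom (κ'.k₃ 1) - α * β * γ * f.hom (κ.k₃ 1) ∈
        Ideal.span {a', b', c'} := by
  subst ha hb hc
  let φ := ProjectiveResolution.lift g P' P
  have comm : φ.f 0 ≫ P.π.f 0 = P'.π.f 0 ≫ g := ProjectiveResolution.lift_commutes_zero g P' P
  refine ⟨_, hf.map φ comm, ?_⟩
  obtain ⟨h₂, hh₂⟩ := κ.exists_apply_k₃_sub κ' hg φ comm
  -- The homotopy error is a cycle of `P`, hence a boundary, and the cocycle `f` kills it.
  obtain ⟨m, hm⟩ := P.exists_dLin_eq 2 _ hh₂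
  have e1 : f.hom (P.dLin 4 3 m) = 0 := ConcreteCategory.congr_hom hf.d_comp m
  rw [hm, map_sub, map_sub, sub_eq_zero] at e1
  refine (exists_apply_d₃_one_iff _ _ _ _).1 ⟨f.hom ∘ₗ h₂, ?_⟩
  rw [LinearMap.comp_apply, ← e1]
  congr 1
  rw [← mul_one (α * β * γ), ← smul_eq_mul, map_smul, map_smul, smul_eq_mul, smul_eq_mul, mul_one]

/-- A morphism in degrees `≤ 3` from a resolution of `A / (aα, bβ, cγ)` to the Koszul complex of
`a, b, c`, which in degrees `0` and `1` factors through the Koszul complex of `aα, bβ, cγ`. -/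
theorem IsProExact.exists_lift {α β γ : A} (hpe : IsProExact a b c α β γ)
    (P' : ProjectiveResolution (quot (a * α) (b * β) (c * γ))) :
    ∃ (l₀ : P'.complex.X 0 →ₗ[A] A) (l₁ : P'.complex.X 1 →ₗ[A] A × A × A)
      (l₂ : P'.complex.X 2 →ₗ[A] A × A × A) (l₃ : P'.complex.X 3 →ₗ[A] A),
      Submodule.mkQ _ ∘ₗ l₀ = P'.aug ∧
      d₁ (a * α) (b * β) (c * γ) ∘ₗ l₁ = l₀ ∘ₗ P'.dLin 1 0 ∧
      d₂ a b c ∘ₗ l₂ = t₁ α β γ ∘ₗ l₁ ∘ₗ P'.dLin 2 1 ∧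
      d₃ a b c ∘ₗ l₃ = l₂ ∘ₗ P'.dLin 3 2 ∧ l₃ ∘ₗ P'.dLin 4 3 = 0 := by
  obtain ⟨l₀, h₀⟩ := Module.projective_lifting_property
    (Submodule.mkQ (Ideal.span {a * α, b * β, c * γ})) P'.aug (Submodule.mkQ_surjective _)
  obtain ⟨l₁, h₁⟩ := Module.Projective.exists_comp_eq_of_range_le
    (d₁ (a * α) (b * β) (c * γ)) (l₀ ∘ₗ P'.dLin 1 0) fun m => by
      refine (exists_d₁_eq_iff _ _ _ _).2 ((Submodule.Quotient.mk_eq_zero _).1 ?_)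
      exact (LinearMap.congr_fun h₀ _).trans (LinearMap.congr_fun P'.aug_comp_dLin m)
  -- The Koszul complex of `aα, bβ, cγ` need not be exact in degree `1`. The lift therefore moves
  -- along `t₁` to that of `a, b, c`, where `exact₁` applies.
  obtain ⟨l₂, h₂⟩ := Module.Projective.exists_comp_eq_of_range_le
    (d₂ a b c) (t₁ α β γ ∘ₗ l₁ ∘ₗ P'.dLin 2 1) fun m => by
      refine hpe.exact₁ _ ((LinearMap.congr_fun h₁ _).trans ?_)
      exact (congrArg l₀ (LinearMap.congr_fun (P'.dLin_comp_dLin 0) m)).trans (map_zero _)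
  obtain ⟨l₃, h₃⟩ := Module.Projective.exists_comp_eq_of_range_le
    (d₃ a b c) (l₂ ∘ₗ P'.dLin 3 2) fun m => by
      refine hpe.exact₂ _ ((LinearMap.congr_fun h₂ _).trans ?_)
      refine (congrArg (fun q => t₁ α β γ (l₁ q))
        (LinearMap.congr_fun (P'.dLin_comp_dLin 1) m)).trans ?_
      simp
  refine ⟨l₀, l₁, l₂, l₃, h₀, h₁, h₂, h₃, LinearMap.ext fun m => hpe.eq_zero _ ?_⟩
  refine (LinearMap.congr_fun h₃ _).trans ?_
  exact (congrArg l₂ (LinearMap.congr_fun (P'.dLin_comp_dLin 2) m)).trans (map_zero _)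

/-- A class of `Ext³` with zero image in the Koszul cohomology dies in the direct limit. -/
theorem IsProExact.map_eq_zero {a' b' c' α β γ : A} (ha : a' = a * α) (hb : b' = b * β)
    (hc : c' = c * γ) (hpe : IsProExact a b c α β γ)
    {P : ProjectiveResolution (quot a b c)} (κ : Comparison P)
    {g : quot a' b' c' ⟶ quot a b c}
    (hg : ∀ r : A, g.hom (Submodule.Quotient.mk r) = Submodule.Quotient.mk r)
    {ξ : Ext3 (quot a b c)} {f : P.complex.X 3 ⟶ ModuleCat.of A A}
    (hf : P.Represents (ModuleCat.of A A) (n := 3) ξ f)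
    (h : f.hom (κ.k₃ 1) ∈ Ideal.span {a, b, c}) :
    Ext3.map g ξ = 0 := by
  subst ha hb hc
  let P' := projectiveResolution (quot (a * α) (b * β) (c * γ))
  let φ := ProjectiveResolution.lift g P' P
  have comm : φ.f 0 ≫ P.π.f 0 = P'.π.f 0 ≫ g := ProjectiveResolution.lift_commutes_zero g P' P
  have hφ : ∀ i j (m : P'.complex.X i),
      P.dLin i j ((φ.f i).hom m) = (φ.f j).hom (P'.dLin i j m) := fun i j m =>
    ConcreteCategory.congr_hom (φ.comm i j) m
  obtain ⟨l₀, l₁, l₂, l₃, v0, v1, v2, v3, -⟩ := hpe.exists_lift P'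
  obtain ⟨h₀, hh₀⟩ := Module.Projective.exists_comp_eq_of_range_le (P.dLin 1 0)
    ((φ.f 0).hom - κ.k₀ ∘ₗ l₀) fun m => by
      refine P.exists_dLin_eq_of_aug_eq_zero _ ?_
      have e1 : P.aug ((φ.f 0).hom m) = g.hom (P'.aug m) :=
        ConcreteCategory.congr_hom comm m
      have e2 := LinearMap.congr_fun v0 m
      have e3 := LinearMap.congr_fun κ.aug_k₀ (l₀ m)
      simp only [LinearMap.comp_apply, Submodule.mkQ_apply] at e2 e3
      rw [LinearMap.sub_apply, map_sub, LinearMap.comp_apply, e1, e3, ← e2, hg, sub_self]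
  have c1 := fun m => LinearMap.congr_fun κ.comm₁ m
  have c2 := fun m => LinearMap.congr_fun κ.comm₂ m
  have c3 := fun m => LinearMap.congr_fun κ.comm₃ m
  have u1 := fun m => LinearMap.congr_fun (d₁_comp_t₁ a b c α β γ) m
  have w1 := fun m => LinearMap.congr_fun v1 m
  have w2 := fun m => LinearMap.congr_fun v2 m
  have w3 := fun m => LinearMap.congr_fun v3 m
  simp only [LinearMap.comp_apply] at c1 c2 c3 u1 w1 w2 w3
  obtain ⟨h₂, hh₂⟩ := Module.Projective.exists_homotopy
    (P'.dLin_comp_dLin 0) (P'.dLin_comp_dLin 1)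
    (d₂ := P.dLin 2 1) (d₃ := P.dLin 3 2) (P.exists_dLin_eq 1)
    (s₁ := (φ.f 1).hom - κ.k₁ ∘ₗ t₁ α β γ ∘ₗ l₁)
    (s₂ := (φ.f 2).hom - κ.k₂ ∘ₗ l₂)
    (s₃ := (φ.f 3).hom - κ.k₃ ∘ₗ l₃)
    (by
      refine LinearMap.ext fun m => ?_
      simp only [LinearMap.comp_apply, LinearMap.sub_apply, map_sub, hφ, c2, w2])
    (by
      refine LinearMap.ext fun m => ?_
      simp only [LinearMap.comp_apply, LinearMap.sub_apply, map_sub, hφ, c3, w3])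
    h₀ (fun m => by
      refine P.exists_dLin_eq 0 _ ?_
      have e := LinearMap.congr_fun hh₀ (P'.dLin 1 0 m)
      simp only [LinearMap.comp_apply, LinearMap.sub_apply, map_sub, hφ, c1, u1, w1] at e ⊢
      rw [e, sub_self])
  -- Membership in the ideal gives `f ∘ k₃ = q ∘ d₃`. Hence `f ∘ k₃ ∘ l₃ = q ∘ l₂ ∘ d` is a
  -- coboundary, and it differs from `f ∘ φ` by the coboundary of `f ∘ h₂`.
  obtain ⟨q, hq⟩ := (exists_apply_d₃_one_iff a b c _).2 h
  refine (hf.map φ comm).eq_zero_iff.2 ⟨ModuleCat.ofHom (q ∘ₗ l₂ + f.hom ∘ₗ h₂), ?_⟩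
  ext m
  obtain ⟨m', hm'⟩ := P.exists_dLin_eq 2 _ (hh₂ m)
  have e1 : f.hom (P.dLin 4 3 m') = 0 := ConcreteCategory.congr_hom hf.d_comp m'
  rw [hm', map_sub, LinearMap.sub_apply, map_sub, LinearMap.comp_apply, sub_sub, sub_eq_zero] at e1
  have e2 : f.hom (κ.k₃ (l₃ m)) = q (l₂ (P'.dLin 3 2 m)) := by
    rw [← w3 m, ← mul_one (l₃ m), ← smul_eq_mul, map_smul, map_smul, map_smul, map_smul, hq]
  rw [e2] at e1
  exact e1.symm

/-- The transition maps hit, up to the direct limit, the class of `1`. -/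
theorem IsProExact.exists_represents {a' b' c' α β γ : A} (ha : a' = a * α) (hb : b' = b * β)
    (hc : c' = c * γ) (hpe : IsProExact a b c α β γ)
    {P' : ProjectiveResolution (quot a' b' c')} (κ' : Comparison P') :
    ∃ ξ f, P'.Represents (ModuleCat.of A A) (n := 3) ξ f ∧
      f.hom (κ'.k₃ 1) - α * β * γ ∈ Ideal.span {a', b', c'} := by
  subst ha hb hc
  obtain ⟨l₀, l₁, l₂, l₃, v0, v1, v2, v3, v4⟩ := hpe.exists_lift P'
  -- The cocycle is `l₃` itself: `l₃ ∘ k₃` agrees up to homotopy with `t₃`, multiplication by `αβγ`.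
  obtain ⟨ξ, hξ⟩ := P'.exists_represented (Y := ModuleCat.of A A) (n := 3)
    (f := ModuleCat.ofHom l₃) (ModuleCat.hom_ext v4)
  refine ⟨ξ, _, hξ, ?_⟩
  obtain ⟨h₀, hh₀⟩ := Module.Projective.exists_comp_eq_of_range_le
    (d₁ (a * α) (b * β) (c * γ)) (l₀ ∘ₗ κ'.k₀ - LinearMap.id) fun m => by
      refine (exists_d₁_eq_iff _ _ _ _).2 ((Submodule.Quotient.mk_eq_zero _).1 ?_)
      have e2 := LinearMap.congr_fun v0 (κ'.k₀ m)
      have e3 := LinearMap.congr_fun κ'.aug_k₀ m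
      simp only [LinearMap.comp_apply, Submodule.mkQ_apply] at e2 e3
      rw [LinearMap.sub_apply, Submodule.Quotient.mk_sub, LinearMap.comp_apply, e2, e3,
        LinearMap.id_apply, sub_self]
  have c1 := fun m => LinearMap.congr_fun κ'.comm₁ m
  have c2 := fun m => LinearMap.congr_fun κ'.comm₂ m
  have c3 := fun m => LinearMap.congr_fun κ'.comm₃ m
  have u2 := fun m => LinearMap.congr_fun (d₂_comp_t₂ a b c α β γ) m
  have u3 := fun m => LinearMap.congr_fun (d₃_comp_t₃ a b c α β γ) m
  have w1 := fun m => LinearMap.congr_fun v1 m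
  have w2 := fun m => LinearMap.congr_fun v2 m
  have w3 := fun m => LinearMap.congr_fun v3 m
  simp only [LinearMap.comp_apply] at c1 c2 c3 u2 u3 w1 w2 w3
  obtain ⟨h₂, hh₂⟩ := Module.Projective.exists_homotopy
    (d₁_comp_d₂ (a * α) (b * β) (c * γ)) (d₂_comp_d₃ (a * α) (b * β) (c * γ))
    (d₂ := d₂ a b c) (d₃ := d₃ a b c) hpe.exact₂
    (s₁ := t₁ α β γ ∘ₗ l₁ ∘ₗ κ'.k₁ - t₁ α β γ)
    (s₂ := l₂ ∘ₗ κ'.k₂ - t₂ α β γ)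
    (s₃ := l₃ ∘ₗ κ'.k₃ - t₃ α β γ)
    (by
      refine LinearMap.ext fun m => ?_
      simp only [LinearMap.comp_apply, LinearMap.sub_apply, map_sub, c2, w2, u2])
    (by
      refine LinearMap.ext fun m => ?_
      simp only [LinearMap.comp_apply, LinearMap.sub_apply, map_sub, c3, w3, u3])
    -- Composing `h₀` with `t₁` puts the whole difference into the image of `t₁` on cycles, where
    -- `exact₁` applies.
    (t₁ α β γ ∘ₗ h₀) (fun m => by
      have e := LinearMap.congr_fun hh₀ (d₁ (a * α) (b * β) (c * γ) m)
      obtain ⟨m', hm'⟩ := hpe.exact₁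
        (l₁ (κ'.k₁ m) - m - h₀ (d₁ (a * α) (b * β) (c * γ) m)) (by
          simp only [LinearMap.comp_apply, LinearMap.sub_apply, map_sub, c1, w1,
            LinearMap.id_apply] at e ⊢
          rw [e, sub_self])
      exact ⟨m', by
        simpa only [map_sub, LinearMap.sub_apply, LinearMap.comp_apply] using hm'⟩)
  have e := hpe.eq_zero _ (hh₂ 1)
  refine (exists_apply_d₃_one_iff _ _ _ _).1 ⟨h₂, ?_⟩
  rw [sub_eq_zero] at e
  rw [← e]
  simp only [LinearMap.sub_apply, LinearMap.comp_apply, t₃, LinearMap.mulLeft_apply, mul_one,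
    ModuleCat.hom_ofHom]

end ThreeKoszul

/-! ### Passage to the direct limit and local cohomology -/

namespace ThreeKoszul

variable {A : Type u} [CommRing A]

open ThreePowers

/-- The map from the system of the `Ext³(A / (aⁿ, bⁿ, cⁿ), A)` to the system of the
`A / (aⁿ, bⁿ, cⁿ)` becomes an isomorphism in the direct limit. -/
theorem exists_toQuot [IsNoetherianRing A] {a b : A} (c : A) (ha : ∀ s, a * s = 0 → s = 0)
    (hb : ∀ s, a ∣ b * s → a ∣ s) :
    ∃ θ : ∀ n : ℕ, Ext3 (quot (a ^ n) (b ^ n) (c ^ n)) →ₗ[A] A ⧸ powIdeal a b c n,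
      (∀ (n n' : ℕ) (h : n ≤ n')
        (g : quot (a ^ n') (b ^ n') (c ^ n') ⟶ quot (a ^ n) (b ^ n) (c ^ n)),
        (∀ r : A, g.hom (Submodule.Quotient.mk r) = Submodule.Quotient.mk r) →
        ∀ ξ, θ n' (Ext3.map g ξ) = transition a b c n n' h (θ n ξ)) ∧
      (∀ (n : ℕ) (ξ), θ n ξ = 0 → ∃ n', n ≤ n' ∧
        ∀ g : quot (a ^ n') (b ^ n') (c ^ n') ⟶ quot (a ^ n) (b ^ n) (c ^ n),
          (∀ r : A, g.hom (Submodule.Quotient.mk r) = Submodule.Quotient.mk r) →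
          Ext3.map g ξ = 0) ∧
      ∀ (n : ℕ) (r : A ⧸ powIdeal a b c n), ∃ (n' : ℕ) (h : n ≤ n') (ξ : _),
        θ n' ξ = transition a b c n n' h r := by
  let P := fun n : ℕ => projectiveResolution (quot (a ^ n) (b ^ n) (c ^ n))
  have κ : ∀ n, Comparison (P n) := fun n => (nonempty_comparison (P n)).some
  have hex : ∀ n, ∃ θ : Ext3 (quot (a ^ n) (b ^ n) (c ^ n)) →ₗ[A] A ⧸ powIdeal a b c n,
      ∀ ξ f, (P n).Represents (ModuleCat.of A A) ξ f →
        θ ξ = Submodule.Quotient.mk (f.hom ((κ n).k₃ 1)) := fun n => (κ n).exists_toQuot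
  choose θ hθ using hex
  refine ⟨θ, ?_, ?_, ?_⟩
  · intro n n' h g hg ξ
    obtain ⟨e, rfl⟩ := Nat.exists_eq_add_of_le h
    obtain ⟨f, hf⟩ := (P n).exists_represents ξ
    obtain ⟨f', hf', hff'⟩ := (κ n).toQuot_map (pow_add a n e) (pow_add b n e) (pow_add c n e)
      (κ (n + e)) hg hf
    rw [hθ _ _ _ hf, hθ _ _ _ hf']
    refine (Submodule.Quotient.eq _).2 ?_
    rwa [LinearMap.mulLeft_apply, Nat.add_sub_cancel_left, mul_pow, mul_pow]
  · intro n ξ hξ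
    obtain ⟨e, hpe⟩ := exists_isProExact c ha hb n
    obtain ⟨f, hf⟩ := (P n).exists_represents ξ
    rw [hθ _ _ _ hf, Submodule.Quotient.mk_eq_zero] at hξ
    exact ⟨n + e, Nat.le_add_right n e, fun g hg => hpe.map_eq_zero (pow_add a n e) (pow_add b n e)
      (pow_add c n e) (κ n) hg hf hξ⟩
  · intro n r
    obtain ⟨r, rfl⟩ := Submodule.Quotient.mk_surjective _ r
    obtain ⟨e, hpe⟩ := exists_isProExact c ha hb n
    obtain ⟨ξ, f, hf, h⟩ := hpe.exists_represents (pow_add a n e) (pow_add b n e) (pow_add c n e)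
      (κ (n + e))
    refine ⟨n + e, Nat.le_add_right n e, r • ξ, ?_⟩
    rw [map_smul, hθ _ _ _ hf]
    refine (Submodule.Quotient.eq _).2 ?_
    have := Ideal.mul_mem_left _ r h
    rw [mul_sub] at this
    rwa [LinearMap.mulLeft_apply, Nat.add_sub_cancel_left, mul_pow, mul_pow, mul_comm _ r]

/-- The ideals `(aⁿ, bⁿ, cⁿ)`, as a diagram. -/
def powIdealDiagram (a b c : A) : ℕᵒᵖ ⥤ Ideal A where
  obj n := powIdeal a b c n.unop
  map {n n'} w := homOfLE (by
    have h : n'.unop ≤ n.unop := leOfHom w.unop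
    rw [powIdeal, Ideal.span_le]
    have key : ∀ t : A, t ∈ ({a, b, c} : Set A) → t ^ n.unop ∈ powIdeal a b c n'.unop := by
      intro t ht
      refine Ideal.pow_mem_of_pow_mem _ (Ideal.subset_span (?_ : t ^ n'.unop ∈ _)) h
      rcases ht with rfl | rfl | rfl <;> simp
    rintro _ (rfl | rfl | rfl) <;> exact key _ (by simp))

theorem powIdeal_le_pow (a b c : A) (n : ℕ) : powIdeal a b c n ≤ Ideal.span {a, b, c} ^ n := by
  rw [powIdeal, Ideal.span_le]
  rintro _ (rfl | rfl | rfl) <;> exact Ideal.pow_mem_pow (Ideal.subset_span (by simp)) n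

theorem le_radical_powIdeal (a b c : A) (n : ℕ) :
    Ideal.span {a, b, c} ≤ (powIdeal a b c n).radical := by
  rw [Ideal.span_le]
  rintro _ (rfl | rfl | rfl) <;> exact ⟨n, Ideal.subset_span (by simp)⟩

/-- The ideals `(aⁿ, bⁿ, cⁿ)`, as a diagram of ideals with radical containing `(a, b, c)`. -/
def powIdealToSelfLERadical (a b c : A) :
    ℕᵒᵖ ⥤ localCohomology.SelfLERadical (Ideal.span {a, b, c}) :=
  ObjectProperty.lift _ (powIdealDiagram a b c) fun n => le_radical_powIdeal a b c n.unop

/-- If the radical of `J` contains `(a, b, c)`, then `J ⊇ (a, b, c)^k ⊇ (a^k, b^k, c^k)` for some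
`k`. Connectedness is automatic because indices are comparable and ideals form a preorder. -/
instance initial_powIdealToSelfLERadical [IsNoetherianRing A] (a b c : A) :
    (powIdealToSelfLERadical a b c).Initial where
  out J' := by
    apply +allowSynthFailures zigzag_isConnected
    · obtain ⟨k, hk⟩ := Ideal.exists_pow_le_of_le_radical_of_fg J'.2
        (isNoetherian_def.mp ‹IsNoetherianRing A› _)
      exact ⟨CostructuredArrow.mk (⟨⟨⟨(powIdeal_le_pow a b c k).trans hk⟩⟩⟩ :
        (powIdealToSelfLERadical a b c).obj (op k) ⟶ J')⟩
    · intro j1 j2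
      apply Relation.ReflTransGen.single
      rcases le_total (unop j1.left) (unop j2.left) with h | h
      · right; exact ⟨CostructuredArrow.homMk (homOfLE h).op rfl⟩
      · left; exact ⟨CostructuredArrow.homMk (homOfLE h).op rfl⟩

/-- Local cohomology with support in `(a, b, c)` as the direct limit over the `(aⁿ, bⁿ, cⁿ)`. -/
noncomputable def localCohomologyIso [IsNoetherianRing A] (a b c : A) (i : ℕ) :
    localCohomology.ofDiagram.{u, 0} (powIdealDiagram a b c) i ≅
      localCohomology (Ideal.span {a, b, c}) i :=
  localCohomology.isoOfFinal.{u, u, 0} (powIdealToSelfLERadical a b c)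
    (localCohomology.selfLERadicalDiagram (Ideal.span {a, b, c})) i ≪≫
    localCohomology.isoSelfLERadical (Ideal.span {a, b, c}) i

/-- If `a, b` is a regular sequence in a Noetherian ring, then the local cohomology module
`H³(A)` with support in `(a, b, c)` is the direct limit of the `A / (aⁿ, bⁿ, cⁿ)`. -/
theorem nonempty_localCohomology_equiv_limit {A : Type} [CommRing A] [IsNoetherianRing A]
    {a b : A} (c : A) (ha : ∀ s, a * s = 0 → s = 0) (hb : ∀ s, a ∣ b * s → a ∣ s) :
    Nonempty (((localCohomology (Ideal.span {a, b, c}) 3).obj (ModuleCat.of A A)) ≃ₗ[A]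
      Limit a b c) := by
  obtain ⟨θ, hnat, hinj, hsurj⟩ := exists_toQuot c ha hb
  let D : ℕᵒᵖᵒᵖ ⥤ ModuleCat.{0} A ⥤ ModuleCat.{0} A :=
    localCohomology.diagram (powIdealDiagram a b c) 3
  let ev := (evaluation (ModuleCat.{0} A) (ModuleCat.{0} A)).obj (ModuleCat.of A A)
  have hcol : IsColimit (ev.mapCocone (colimit.cocone D)) :=
    isColimitOfPreserves ev (colimit.isColimit D)
  have hmap : ∀ {j j' : ℕᵒᵖᵒᵖ} (w : j ⟶ j'), ∃ g : quot (a ^ j'.unop.unop) (b ^ j'.unop.unop)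
      (c ^ j'.unop.unop) ⟶ quot (a ^ j.unop.unop) (b ^ j.unop.unop) (c ^ j.unop.unop),
      (∀ r : A, g.hom (Submodule.Quotient.mk r) = Submodule.Quotient.mk r) ∧
        (D ⋙ ev).map w = Ext3.map g := fun w =>
    ⟨(localCohomology.ringModIdeals (powIdealDiagram a b c)).map w.unop, fun r => rfl, rfl⟩
  have hle : ∀ {j j' : ℕᵒᵖᵒᵖ} (_ : j ⟶ j'), j.unop.unop ≤ j'.unop.unop := fun w =>
    leOfHom w.unop.unop
  let K : Cocone (D ⋙ ev) :=
    { pt := ModuleCat.of A (Limit a b c)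
      ι :=
        { app j := ModuleCat.ofHom (Module.DirectLimit.of A ℕ _ (transition a b c) j.unop.unop ∘ₗ
            θ j.unop.unop)
          naturality j j' w := by
            obtain ⟨g, hg, hw⟩ := hmap w
            ext ξ
            have e1 := hnat _ _ (hle w) g hg ξ
            have e2 : (D ⋙ ev).map w ξ = Ext3.map g ξ := ConcreteCategory.congr_hom hw ξ
            refine (congrArg (fun ζ => Module.DirectLimit.of A ℕ _ (transition a b c) j'.unop.unop
              (θ j'.unop.unop ζ)) e2).trans ?_
            refine (congrArg _ e1).trans ?_
            exact Module.DirectLimit.of_f } }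
  let F : (ev.mapCocone (colimit.cocone D)).pt ⟶ ModuleCat.of A (Limit a b c) := hcol.desc K
  have hF : ∀ (j : ℕᵒᵖᵒᵖ) (ξ : (D ⋙ ev).obj j), F ((ev.mapCocone (colimit.cocone D)).ι.app j ξ) =
      Module.DirectLimit.of A ℕ _ (transition a b c) j.unop.unop (θ j.unop.unop ξ) :=
    fun j ξ => ConcreteCategory.congr_hom (hcol.fac K j) ξ
  have hFinj : Function.Injective F := by
    rw [injective_iff_map_eq_zero]
    intro m hm
    obtain ⟨j, ξ, rfl⟩ := Concrete.isColimit_exists_rep _ hcol m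
    -- Two transitions are needed: at `n'` the image under `θ` vanishes, and at `n''` the `Ext`
    -- class itself does.
    obtain ⟨n', h, hn'⟩ := Module.DirectLimit.of.zero_exact ((hF j ξ).symm.trans hm)
    let w : j ⟶ op (op n') := (homOfLE h).op.op
    obtain ⟨g, hg, hw⟩ := hmap w
    obtain ⟨n'', h', hn''⟩ := hinj n' _ ((hnat _ _ h g hg ξ).trans hn')
    let w' : op (op n') ⟶ op (op n'') := (homOfLE h').op.op
    obtain ⟨g', hg', hw'⟩ := hmap w'
    have e1 : (D ⋙ ev).map (w ≫ w') ξ = 0 := by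
      rw [Functor.map_comp, hw, hw']
      exact hn'' g' hg'
    refine (ConcreteCategory.congr_hom
      ((ev.mapCocone (colimit.cocone D)).w (w ≫ w')) ξ).symm.trans ?_
    exact (congrArg _ e1).trans
      (map_zero ((ev.mapCocone (colimit.cocone D)).ι.app (op (op n''))).hom)
  have hFsurj : Function.Surjective F := by
    intro m
    obtain ⟨n, r, rfl⟩ := Module.DirectLimit.exists_of m
    obtain ⟨n', h, ξ, hξ⟩ := hsurj n r
    refine ⟨(ev.mapCocone (colimit.cocone D)).ι.app (op (op n')) ξ, (hF (op (op n')) ξ).trans ?_⟩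
    refine (congrArg _ hξ).trans Module.DirectLimit.of_f
  exact ⟨(((localCohomologyIso a b c 3).app (ModuleCat.of A A)).symm.toLinearEquiv).trans
    (LinearEquiv.ofBijective F.hom ⟨hFinj, hFsurj⟩)⟩

end ThreeKoszul

end LocalCohomology

theorem mainTheorem2 :
    -- the identification of `H³_𝔞(R)` with the direct limit of the `R/(xᵏ, yᵏ, zᵏ)R`
    Nonempty (HypersurfaceRing.H3 ≃ₗ[HypersurfaceRing]
      ThreePowers.Limit HypersurfaceRing.x HypersurfaceRing.y HypersurfaceRing.z) ∧
    -- the classes `η` are well defined, nonzero and `p`-torsion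
    (∀ p : ℕ, p.Prime →
      ∃ l : HypersurfaceRing,
        (∀ l' : HypersurfaceRing,
          (p : HypersurfaceRing) * l' =
              (HypersurfaceRing.u * HypersurfaceRing.x) ^ p
                + (HypersurfaceRing.v * HypersurfaceRing.y) ^ p
                + (HypersurfaceRing.w * HypersurfaceRing.z) ^ p ↔ l' = l) ∧
        ∀ e : HypersurfaceRing.H3 ≃ₗ[HypersurfaceRing]
            ThreePowers.Limit HypersurfaceRing.x HypersurfaceRing.y HypersurfaceRing.z,
          e.symm (ThreePowers.cls HypersurfaceRing.x HypersurfaceRing.y HypersurfaceRing.z p l) ≠ 0 ∧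
          (p : HypersurfaceRing) •
            e.symm (ThreePowers.cls HypersurfaceRing.x HypersurfaceRing.y HypersurfaceRing.z p l)
              = 0) ∧
    -- infinitely many associated primes
    (associatedPrimes HypersurfaceRing HypersurfaceRing.H3).Infinite := by
  have hiso : Nonempty (HypersurfaceRing.H3 ≃ₗ[HypersurfaceRing]
      ThreePowers.Limit HypersurfaceRing.x HypersurfaceRing.y HypersurfaceRing.z) :=
    ThreeKoszul.nonempty_localCohomology_equiv_limit HypersurfaceRing.z
      HypersurfaceRing.x_regular HypersurfaceRing.y_regular_mod_x
  refine ⟨hiso, fun p hp => ?_, ?_⟩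
  · obtain ⟨l, hl⟩ := HypersurfaceRing.exists_prime_mul_eq hp
    refine ⟨l, fun l' => ⟨fun hl' => ?_, fun h => h ▸ hl⟩, fun e => ⟨?_, ?_⟩⟩
    · refine sub_eq_zero.1 (HypersurfaceRing.eq_zero_of_prime_mul_eq_zero hp ?_)
      rw [mul_sub, hl', hl, sub_self]
    · exact e.symm.map_ne_zero_iff.2 (HypersurfaceRing.cls_ne_zero hp hl)
    · rw [← map_smul, HypersurfaceRing.prime_smul_cls_eq_zero hl, map_zero]
  · obtain ⟨e⟩ := hiso
    refine HypersurfaceRing.associatedPrimes_infinite_of_prime_torsion fun p hp => ?_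
    obtain ⟨l, hl⟩ := HypersurfaceRing.exists_prime_mul_eq hp
    refine ⟨e.symm (ThreePowers.cls _ _ _ p l),
      e.symm.map_ne_zero_iff.2 (HypersurfaceRing.cls_ne_zero hp hl), ?_⟩
    rw [← map_smul, HypersurfaceRing.prime_smul_cls_eq_zero hl, map_zero]
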